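/- All algebras are complex, associative and unital, and algebra homomorphisms preserve units. A Fréchet space is a complete metrizable locally convex topological vector space over $\mathbb{C}$; a Fréchet algebra $A$ is an algebra whose underlying space is a Fréchet space and whose multiplication $A\times A\to A$ is continuous; a Fréchet $A$-bimodule is a (unital) $A$-bimodule that is a Fréchet space with continuous left and right actions. The category of Fréchet algebras has the continuous algebra homomorphisms as its morphisms. $\mathrm{Der}(A,M)$ is the space of continuous derivations from $A$ to a Fréchet $A$-bimodule $M$, i.e. continuous linear maps $D\colon A\to M$ with $D(ab)=a\,D(b)+D(a)\,b$. We write $\hat\otimes$ for the completed projective tensor product; for a right module $M$ and a left module $N$ over $A$, $M\hat\otimes_A N$ is the quotient of $M\hat\otimes N$ by the closed linear span of all elements $xa\otimes y-x\otimes ay$ ($x\in M$, $a\in A$, $y\in N$). Finally, $\Omega^1A$ is the kernel of the multiplication map $A\hat\otimes A\to A$, with the $A$-bimodule structure induced by $a\cdot(x\otimes y)\cdot b=ax\otimes yb$. Theorem. Let $\varphi\colon A\to B$ be a continuous homomorphism of Fréchet algebras. View every Fréchet $B$-bimodule as a Fréchet $A$-bimodule via $\varphi$. The following conditions are equivalent: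 (i) $\varphi$ is an epimorphism in the category of Fréchet algebras; (ii) for every Fréchet $B$-bimodule $X$, the linear map $\mathrm{Der}(B,X)\to\mathrm{Der}(A,X)$, $D\mapsto D\circ\varphi$, is injective; (iii) the canonical $B$-bimodule morphism $\check\varphi\colon B\hat\otimes_A\Omega^1A\hat\otimes_A B\to\Omega^1B$, that is, the continuous linear map determined by $\check\varphi(b\otimes\omega\otimes b')=b\cdot(\varphi\hat\otimes\varphi)(\omega)\cdot b'$ for $b,b'\in B$, $\omega\in\Omega^1A$, has dense image in $\Omega^1B$. -/

import Mathlib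

open CategoryTheory MulOpposite
open scoped TensorProduct Topology

universe u

set_option linter.unusedSectionVars false

noncomputable section

/-! ## Fréchet spaces, algebras and bimodules -/

/-- A complex Fréchet space: a complete metrizable locally convex topological vector space. The
uniform structure is the one determined by the vector space topology. -/
class FrechetSpace (E : Type*) [AddCommGroup E] [Module ℂ E] [UniformSpace E] : Prop
    extends IsUniformAddGroup E, ContinuousSMul ℂ E, LocallyConvexSpace ℝ E, CompleteSpace E,
      TopologicalSpace.MetrizableSpace E

/-- A (unital, associative, complex) Fréchet algebra: a Fréchet space with a jointly continuous
multiplication. -/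
class FrechetAlgebra (A : Type*) [Ring A] [Algebra ℂ A] [UniformSpace A] : Prop
    extends FrechetSpace A, ContinuousMul A

/-- Compatibility of a left and a right action (the latter written as an action of `Aᵐᵒᵖ`) with
each other, with the complex scalars and with the topology. A Fréchet `A`-bimodule is a Fréchet
space with this structure. -/
class ContinuousBimodule (A M : Type*) [Ring A] [Algebra ℂ A] [TopologicalSpace A]
    [AddCommGroup M] [Module ℂ M] [TopologicalSpace M] [Module A M] [Module Aᵐᵒᵖ M] : Prop
    extends IsScalarTower ℂ A M, SMulCommClass A Aᵐᵒᵖ M, ContinuousSMul A M where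
  isScalarTower_op : IsScalarTower ℂ Aᵐᵒᵖ M
  continuousSMul_op : ContinuousSMul Aᵐᵒᵖ M

attribute [instance] ContinuousBimodule.isScalarTower_op ContinuousBimodule.continuousSMul_op

instance ContinuousBimodule.self (A : Type*) [Ring A] [Algebra ℂ A] [UniformSpace A]
    [FrechetAlgebra A] : ContinuousBimodule A A where
  smul_assoc c a x := by simp
  isScalarTower_op := ⟨fun c a x => by
    simp [MulOpposite.smul_eq_mul_unop]⟩
  continuousSMul_op := inferInstance

/-! ## The category of Fréchet algebras -/

/-- Objects of the category of Fréchet algebras. -/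
structure FrechetAlg : Type (u + 1) where
  carrier : Type u
  [ring : Ring carrier]
  [algebra : Algebra ℂ carrier]
  [uniformSpace : UniformSpace carrier]
  [frechetAlgebra : FrechetAlgebra carrier]

namespace FrechetAlg

attribute [instance] ring algebra uniformSpace frechetAlgebra

/-- Morphisms are the continuous unital algebra homomorphisms. -/
instance : Category FrechetAlg.{u} where
  Hom A B := A.carrier →A[ℂ] B.carrier
  id A := ContinuousAlgHom.id ℂ A.carrier
  comp f g := g.comp f

/-- The object given by a Fréchet algebra. -/
abbrev of (A : Type u) [Ring A] [Algebra ℂ A] [UniformSpace A] [FrechetAlgebra A] :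
    FrechetAlg.{u} :=
  ⟨A⟩

/-- The morphism given by a continuous algebra homomorphism. -/
abbrev ofHom {A B : Type u} [Ring A] [Algebra ℂ A] [UniformSpace A] [FrechetAlgebra A]
    [Ring B] [Algebra ℂ B] [UniformSpace B] [FrechetAlgebra B] (φ : A →A[ℂ] B) : of A ⟶ of B :=
  φ

end FrechetAlg

/-! ## Auxiliary facts on seminorms -/

open scoped ComplexOrder in
theorem polynormableSpace_of_locallyConvex (E : Type*) [AddCommGroup E] [Module ℂ E]
    [TopologicalSpace E] [IsTopologicalAddGroup E] [ContinuousSMul ℂ E] [LocallyConvexSpace ℝ E] :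
    PolynormableSpace ℂ E := by
  have : LocallyConvexSpace ℂ E := by
    refine ⟨fun x => ?_⟩
    refine (LocallyConvexSpace.convex_basis (𝕜 := ℝ) x).congr (fun s => ?_) (fun _ _ => rfl)
    refine and_congr_right fun _ => ⟨fun h => ?_, fun h => Convex.lift ℝ h⟩
    refine convex_of_nonneg_surjective_algebraMap _ (fun c hc => ?_) h
    obtain ⟨r, hr, rfl⟩ := RCLike.nonneg_iff_exists_ofReal.mp (Set.mem_Ici.1 hc)
    exact ⟨r, hr, rfl⟩
  have : ContinuousSMul ℝ E := IsScalarTower.continuousSMul ℂ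
  exact LocallyConvexSpace.toPolynormableSpace

instance FrechetSpace.polynormable (E : Type*) [AddCommGroup E] [Module ℂ E] [UniformSpace E]
    [FrechetSpace E] : PolynormableSpace ℂ E :=
  polynormableSpace_of_locallyConvex E

/-- A neighbourhood of zero contains the open unit ball of a continuous seminorm. -/
theorem exists_seminorm_ball_subset {E : Type*} [AddCommGroup E] [Module ℂ E] [TopologicalSpace E]
    [PolynormableSpace ℂ E] {U : Set E} (hU : U ∈ 𝓝 (0 : E)) :
    ∃ p : Seminorm ℂ E, Continuous p ∧ ∀ x, p x < 1 → x ∈ U := by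
  have hw := PolynormableSpace.withSeminorms ℂ E
  have := hw.topologicalAddGroup
  have := hw.continuousSMul
  obtain ⟨⟨s, r⟩, hr, hs⟩ := hw.hasBasis_zero_ball.mem_iff.1 hU
  dsimp only at hr hs
  have hc : Continuous ⇑(s.sup fun p : {p : Seminorm ℂ E // Continuous p} => p.1 :
      Seminorm ℂ E) := by
    refine Seminorm.continuous (r := 1) ?_
    exact hw.hasBasis_zero_ball.mem_of_mem (i := (s, 1)) one_pos
  refine ⟨Real.toNNReal r⁻¹ •
    (s.sup fun p : {p : Seminorm ℂ E // Continuous p} => p.1), ?_, fun x hx => hs ?_⟩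
  · exact (continuous_const.mul hc : Continuous fun x => ((Real.toNNReal r⁻¹ : NNReal) : ℝ) * _)
  · rw [Seminorm.mem_ball_zero]
    have hx' : ((Real.toNNReal r⁻¹ : NNReal) : ℝ) *
      (s.sup fun p : {p : Seminorm ℂ E // Continuous p} => p.1) x < 1 := hx
    rwa [Real.coe_toNNReal _ (by positivity), inv_mul_lt_iff₀ hr, mul_one] at hx'

theorem seminorm_inv_smul_lt_one {K : Type*} [AddCommGroup K] [Module ℂ K] (r : Seminorm ℂ K)
    (k : K) (a : ℝ) (ha : r k < a) : r ((a⁻¹ : ℂ) • k) < 1 := by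
  have ha0 : 0 < a := (apply_nonneg r k).trans_lt ha
  rw [map_smul_eq_mul, norm_inv, Complex.norm_real, Real.norm_of_nonneg ha0.le,
    inv_mul_lt_iff₀ ha0, mul_one]
  exact ha

/-- A continuous seminorm of a continuous trilinear map is bounded by a product of continuous
seminorms. -/
theorem exists_seminorm_bound₃ {C E F G : Type*}
    [AddCommGroup C] [Module ℂ C] [TopologicalSpace C] [PolynormableSpace ℂ C]
    [AddCommGroup E] [Module ℂ E] [TopologicalSpace E] [PolynormableSpace ℂ E]
    [AddCommGroup F] [Module ℂ F] [TopologicalSpace F] [PolynormableSpace ℂ F]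
    [AddCommGroup G] [Module ℂ G] [TopologicalSpace G]
    (f : C →ₗ[ℂ] E →ₗ[ℂ] F →ₗ[ℂ] G)
    (hf : Continuous fun p : C × E × F => f p.1 p.2.1 p.2.2)
    (R : Seminorm ℂ G) (hR : Continuous R) :
    ∃ (s : Seminorm ℂ C) (p : Seminorm ℂ E) (q : Seminorm ℂ F),
      Continuous s ∧ Continuous p ∧ Continuous q ∧ ∀ c x y, R (f c x y) ≤ s c * (p x * q y) := by
  have h0 : {z : C × E × F | R (f z.1 z.2.1 z.2.2) < 1} ∈ 𝓝 ((0 : C), (0 : E), (0 : F)) := by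
    refine (hR.comp hf).continuousAt.eventually_lt continuousAt_const ?_
    simp
  rw [nhds_prod_eq, nhds_prod_eq, Filter.mem_prod_iff] at h0
  obtain ⟨U, hU, V', hV', h0⟩ := h0
  obtain ⟨V, hV, W, hW, h1⟩ := Filter.mem_prod_iff.1 hV'
  obtain ⟨s, hs, hsU⟩ := exists_seminorm_ball_subset hU
  obtain ⟨p, hp, hpV⟩ := exists_seminorm_ball_subset hV
  obtain ⟨q, hq, hqW⟩ := exists_seminorm_ball_subset hW
  refine ⟨s, p, q, hs, hp, hq, fun c x y => ?_⟩
  have key : ∀ a > s c, ∀ b > p x, ∀ d > q y, R (f c x y) ≤ a * (b * d) := by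
    intro a ha b hb d hd
    have ha0 : 0 < a := (apply_nonneg s c).trans_lt ha
    have hb0 : 0 < b := (apply_nonneg p x).trans_lt hb
    have hd0 : 0 < d := (apply_nonneg q y).trans_lt hd
    have h2 : R (f ((a⁻¹ : ℂ) • c) ((b⁻¹ : ℂ) • x) ((d⁻¹ : ℂ) • y)) < 1 :=
      h0 (Set.mk_mem_prod (hsU _ (seminorm_inv_smul_lt_one s c a ha))
        (h1 (Set.mk_mem_prod (hpV _ (seminorm_inv_smul_lt_one p x b hb)) (hqW _ (seminorm_inv_smul_lt_one q y d hd)))))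
    simp only [map_smul, LinearMap.smul_apply, map_smul_eq_mul, norm_inv, Complex.norm_real,
      Real.norm_of_nonneg ha0.le, Real.norm_of_nonneg hb0.le, Real.norm_of_nonneg hd0.le] at h2
    have h3 : R (f c x y) = a * (b * d) * (d⁻¹ * (b⁻¹ * (a⁻¹ * R (f c x y)))) := by
      field_simp
    rw [h3]
    refine mul_le_of_le_one_right (by positivity) ?_
    nlinarith [h2]
  refine le_mul_of_forall_lt₀ fun a ha m hm => ?_
  have ha0 : 0 < a := (apply_nonneg s c).trans_lt ha
  have h4 : R (f c x y) / a ≤ p x * q y := by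
    refine le_mul_of_forall_lt₀ fun b hb d hd => ?_
    rw [div_le_iff₀' ha0]
    exact key a ha b hb d hd
  rw [div_le_iff₀' ha0] at h4
  exact h4.trans (mul_le_mul_of_nonneg_left hm.le ha0.le)

/-! ## The completed projective tensor product -/

section ProjTensor

variable (E F : Type*) [AddCommGroup E] [Module ℂ E] [AddCommGroup F] [Module ℂ F]

/-- The algebraic tensor product of two locally convex spaces, to be equipped with the projective
topology. -/
def ProjTensor : Type _ := E ⊗[ℂ] F

namespace ProjTensor

instance : AddCommGroup (ProjTensor E F) := inferInstanceAs (AddCommGroup (E ⊗[ℂ] F))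
instance : Module ℂ (ProjTensor E F) := inferInstanceAs (Module ℂ (E ⊗[ℂ] F))

/-- The canonical bilinear map. -/
def mk : E →ₗ[ℂ] F →ₗ[ℂ] ProjTensor E F := TensorProduct.mk ℂ E F

theorem ind {E F : Type*} [AddCommGroup E] [Module ℂ E] [AddCommGroup F] [Module ℂ F]
    {P : ProjTensor E F → Prop} (t : ProjTensor E F) (h0 : P 0)
    (hmk : ∀ x y, P (mk E F x y)) (hadd : ∀ s t, P s → P t → P (s + t)) : P t :=
  TensorProduct.induction_on t h0 hmk hadd

/-- There is a largest seminorm bounded by `p x * q y` on elementary tensors. -/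
theorem exists_cross_seminorm {E F : Type*} [AddCommGroup E] [Module ℂ E]
    [AddCommGroup F] [Module ℂ F] (p : Seminorm ℂ E) (q : Seminorm ℂ F) :
    ∃ π : Seminorm ℂ (ProjTensor E F), (∀ x y, π (mk E F x y) ≤ p x * q y) ∧
      ∀ (ρ : Seminorm ℂ (ProjTensor E F)) (c : ℝ), 0 ≤ c →
        (∀ x y, ρ (mk E F x y) ≤ c * (p x * q y)) → ∀ t, ρ t ≤ c * π t := by
  set S : Set (Seminorm ℂ (ProjTensor E F)) := {ρ | ∀ x y, ρ (mk E F x y) ≤ p x * q y} with hS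
  have hbdd : BddAbove S := by
    rw [Seminorm.bddAbove_iff, bddAbove_def]
    have : ∀ t : ProjTensor E F, ∃ B : ℝ, ∀ ρ ∈ S, ρ t ≤ B := by
      intro t
      induction t using ProjTensor.ind with
      | h0 => exact ⟨0, fun ρ _ => (map_zero ρ).le⟩
      | hmk x y => exact ⟨p x * q y, fun ρ hρ => hρ x y⟩
      | hadd s t hs ht =>
        obtain ⟨B, hB⟩ := hs
        obtain ⟨B', hB'⟩ := ht
        exact ⟨B + B', fun ρ hρ => (map_add_le_add ρ s t).trans (add_le_add (hB ρ hρ) (hB' ρ hρ))⟩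
    choose B hB using this
    refine ⟨B, ?_⟩
    rintro _ ⟨ρ, hρ, rfl⟩ t
    exact hB t ρ hρ
  have hne : S.Nonempty := ⟨0, fun x y => by simpa using by positivity⟩
  refine ⟨sSup S, fun x y => ?_, fun ρ c hc hρ t => ?_⟩
  · rw [Seminorm.sSup_apply hbdd]
    have : Nonempty S := hne.to_subtype
    exact ciSup_le fun ρ => ρ.2 x y
  · rcases hc.eq_or_lt with rfl | hc
    · rw [zero_mul]
      induction t using ProjTensor.ind with
      | h0 => simp
      | hmk x y => simpa using hρ x y
      | hadd s t hs ht => exact (map_add_le_add ρ s t).trans (by linarith)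
    · have hm : Real.toNNReal c⁻¹ • ρ ∈ S := fun x y => by
        change ((Real.toNNReal c⁻¹ : NNReal) : ℝ) * ρ _ ≤ _
        rw [Real.coe_toNNReal _ (by positivity), inv_mul_le_iff₀ hc]
        exact hρ x y
      have h := le_csSup hbdd hm t
      change ((Real.toNNReal c⁻¹ : NNReal) : ℝ) * ρ t ≤ _ at h
      rwa [Real.coe_toNNReal _ (by positivity), inv_mul_le_iff₀ hc] at h

variable [TopologicalSpace E] [TopologicalSpace F]

/-- All seminorms on `E ⊗ F` whose composition with the canonical bilinear map `E × F → E ⊗ F` is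
continuous. -/
def seminorms : SeminormFamily ℂ (ProjTensor E F)
    {r : Seminorm ℂ (ProjTensor E F) // Continuous fun z : E × F => r (mk E F z.1 z.2)} :=
  Subtype.val

instance : Nonempty
    {r : Seminorm ℂ (ProjTensor E F) // Continuous fun z : E × F => r (mk E F z.1 z.2)} :=
  ⟨⟨0, continuous_const⟩⟩

/-- The projective topology, i.e. the finest locally convex topology on `E ⊗ F` for which the
canonical bilinear map `E × F → E ⊗ F` is continuous, with its uniform structure. -/
instance : UniformSpace (ProjTensor E F) :=
  letI : TopologicalSpace (ProjTensor E F) := (seminorms E F).moduleFilterBasis.topology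
  haveI : WithSeminorms (seminorms E F) := ⟨rfl⟩
  haveI := this.topologicalAddGroup
  IsTopologicalAddGroup.rightUniformSpace (ProjTensor E F)

theorem withSeminorms : WithSeminorms (seminorms E F) := ⟨rfl⟩

instance : IsTopologicalAddGroup (ProjTensor E F) := (withSeminorms E F).topologicalAddGroup
instance : IsUniformAddGroup (ProjTensor E F) := isUniformAddGroup_of_addCommGroup
instance : ContinuousSMul ℂ (ProjTensor E F) := (withSeminorms E F).continuousSMul
instance : PolynormableSpace ℂ (ProjTensor E F) := (withSeminorms E F).toPolynormableSpace
instance : UniformContinuousConstSMul ℂ (ProjTensor E F) :=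
  uniformContinuousConstSMul_of_continuousConstSMul ℂ _

variable {E F}

/-- A seminorm dominated on elementary tensors by a product of continuous seminorms is one of the
seminorms defining the projective topology. -/
theorem continuous_of_bound [IsTopologicalAddGroup E] [IsTopologicalAddGroup F]
    (ρ : Seminorm ℂ (ProjTensor E F)) {p : Seminorm ℂ E} {q : Seminorm ℂ F} (hp : Continuous p)
    (hq : Continuous q) (h : ∀ x y, ρ (mk E F x y) ≤ p x * q y) :
    Continuous fun z : E × F => ρ (mk E F z.1 z.2) := by
  rw [continuous_iff_continuousAt]
  rintro ⟨x₀, y₀⟩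
  have hb : Continuous fun z : E × F =>
      p (z.1 - x₀) * q (z.2 - y₀) + (p x₀ * q (z.2 - y₀) + p (z.1 - x₀) * q y₀) := by
    fun_prop
  have hb0 := hb.tendsto (x₀, y₀)
  simp only [sub_self, map_zero, mul_zero, zero_mul, add_zero] at hb0
  rw [ContinuousAt, tendsto_iff_norm_sub_tendsto_zero]
  refine squeeze_zero (fun _ => norm_nonneg _) (fun z => ?_) hb0
  have h1 : mk E F z.1 z.2 - mk E F x₀ y₀ = mk E F (z.1 - x₀) (z.2 - y₀) +
      (mk E F x₀ (z.2 - y₀) + mk E F (z.1 - x₀) y₀) := by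
    simp only [map_sub, LinearMap.sub_apply]
    abel
  refine (abs_sub_map_le_sub ρ _ _).trans ?_
  rw [h1]
  exact (map_add_le_add ρ _ _).trans
    (add_le_add (h _ _) ((map_add_le_add ρ _ _).trans (add_le_add (h _ _) (h _ _))))

/-- The continuous linear map on `E ⊗ F` given by a jointly continuous bilinear map. -/
def liftL {G : Type*} [AddCommGroup G] [Module ℂ G] [TopologicalSpace G] [PolynormableSpace ℂ G]
    (f : E →ₗ[ℂ] F →ₗ[ℂ] G) (hf : Continuous fun z : E × F => f z.1 z.2) :
    ProjTensor E F →L[ℂ] G where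
  toLinearMap := (TensorProduct.lift f : E ⊗[ℂ] F →ₗ[ℂ] G)
  cont := by
    refine (PolynormableSpace.withSeminorms ℂ G).continuous_of_continuous_comp
      (TensorProduct.lift f : E ⊗[ℂ] F →ₗ[ℂ] G) (E := ProjTensor E F) fun r => ?_
    refine (withSeminorms E F).continuous_seminorm
      ⟨r.1.comp (TensorProduct.lift f : E ⊗[ℂ] F →ₗ[ℂ] G), ?_⟩
    refine (r.2.comp hf).congr fun z => ?_
    exact congrArg r.1 (TensorProduct.lift.tmul z.1 z.2).symm

theorem liftL_mk {G : Type*} [AddCommGroup G] [Module ℂ G] [TopologicalSpace G]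
    [PolynormableSpace ℂ G] (f : E →ₗ[ℂ] F →ₗ[ℂ] G)
    (hf : Continuous fun z : E × F => f z.1 z.2) (x : E) (y : F) :
    liftL f hf (mk E F x y) = f x y :=
  TensorProduct.lift.tmul x y

theorem continuous_mk [IsTopologicalAddGroup E] [IsTopologicalAddGroup F] :
    Continuous fun z : E × F => mk E F z.1 z.2 := by
  have h0 : ∀ z : E × F, mk E F z.1 z.2 = 0 → ContinuousAt (fun z => mk E F z.1 z.2) z := by
    intro x₀ h
    rw [ContinuousAt, (withSeminorms E F).tendsto_nhds]
    intro r ε hε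
    have h1 := r.2.continuousAt (x := x₀)
    refine (h1.eventually_lt (continuousAt_const (y := ε)) ?_).mono fun x hx => ?_
    · simpa [h] using hε
    · rw [h, sub_zero]
      exact hx
  refine continuous_of_continuousAt_zero₂
    (LinearMap.toAddMonoidHom'.comp (mk E F).toAddMonoidHom) ?_ (fun x => ?_) (fun y => ?_)
  · exact h0 (0, 0) (by simp)
  · exact (h0 (x, 0) (by simp)).comp (f := fun y => (x, y)) (by fun_prop)
  · exact (h0 (0, y) (by simp)).comp (f := fun x => (x, y)) (by fun_prop)

end ProjTensor

end ProjTensor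

/-- The completed projective tensor product `E ⊗̂ F`: the (Hausdorff) completion of `E ⊗ F` in the
projective topology. -/
def CompletedTensor (E F : Type*) [AddCommGroup E] [Module ℂ E] [TopologicalSpace E]
    [AddCommGroup F] [Module ℂ F] [TopologicalSpace F] : Type _ :=
  UniformSpace.Completion (ProjTensor E F)

namespace CompletedTensor

section basic

variable (E F : Type*) [AddCommGroup E] [Module ℂ E] [TopologicalSpace E]
  [AddCommGroup F] [Module ℂ F] [TopologicalSpace F]

instance : AddCommGroup (CompletedTensor E F) :=
  inferInstanceAs (AddCommGroup (UniformSpace.Completion (ProjTensor E F)))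
instance : Module ℂ (CompletedTensor E F) :=
  inferInstanceAs (Module ℂ (UniformSpace.Completion (ProjTensor E F)))
instance : UniformSpace (CompletedTensor E F) :=
  inferInstanceAs (UniformSpace (UniformSpace.Completion (ProjTensor E F)))
instance : IsUniformAddGroup (CompletedTensor E F) :=
  inferInstanceAs (IsUniformAddGroup (UniformSpace.Completion (ProjTensor E F)))
instance : CompleteSpace (CompletedTensor E F) :=
  inferInstanceAs (CompleteSpace (UniformSpace.Completion (ProjTensor E F)))
instance : T2Space (CompletedTensor E F) :=
  inferInstanceAs (T2Space (UniformSpace.Completion (ProjTensor E F)))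

/-- The canonical map from the algebraic tensor product to its completion. -/
def ofTensor : ProjTensor E F →L[ℂ] CompletedTensor E F where
  toFun t := (t : UniformSpace.Completion (ProjTensor E F))
  map_add' s t := UniformSpace.Completion.coe_add s t
  map_smul' c t := UniformSpace.Completion.coe_smul c t
  cont := UniformSpace.Completion.continuous_coe _

theorem isDenseInducing_ofTensor : IsDenseInducing (ofTensor E F) :=
  UniformSpace.Completion.isDenseInducing_coe

variable {E F} in
/-- A biadditive map on `C × (E ⊗̂ F)` which is continuous in the second variable is jointly
continuous if it is so on the algebraic tensor product. -/
theorem continuous_of_ofTensor {C G : Type*} [AddCommGroup C] [TopologicalSpace C]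
    [IsTopologicalAddGroup C] [AddCommGroup G] [UniformSpace G] [IsUniformAddGroup G]
    [CompleteSpace G] [T2Space G] (b : C →+ CompletedTensor E F →+ G) (hb : ∀ c, Continuous (b c))
    (h : Continuous fun z : C × ProjTensor E F => b z.1 (ofTensor E F z.2)) :
    Continuous fun z : C × CompletedTensor E F => b z.1 z.2 := by
  have de : IsDenseInducing (AddMonoidHom.id C) :=
    (Homeomorph.refl C).isDenseEmbedding.isDenseInducing
  have df : IsDenseInducing (ofTensor E F).toLinearMap.toAddMonoidHom :=
    isDenseInducing_ofTensor E F
  let φ : C →+ ProjTensor E F →+ G :=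
    (AddMonoidHom.compHom' (ofTensor E F).toLinearMap.toAddMonoidHom).comp b
  have hφ : Continuous fun z : C × ProjTensor E F => φ z.1 z.2 := h
  have hext := IsDenseInducing.extend_Z_bilin de df hφ
  refine hext.congr fun ⟨c, t⟩ => ?_
  refine congrFun (df.dense.equalizer
    (hext.comp (Continuous.prodMk_right c)) (hb c) (funext fun t => ?_)) t
  exact (de.prodMap df).extend_eq hφ (c, t)

instance : ContinuousSMul ℂ (CompletedTensor E F) := by
  have : UniformContinuousConstSMul ℂ (CompletedTensor E F) :=
    inferInstanceAs (UniformContinuousConstSMul ℂ (UniformSpace.Completion (ProjTensor E F)))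
  refine ⟨continuous_of_ofTensor (smulAddHom ℂ (CompletedTensor E F))
    (fun c => continuous_const_smul c) ?_⟩
  refine ((ofTensor E F).continuous.comp
    (continuous_smul : Continuous fun z : ℂ × ProjTensor E F => z.1 • z.2)).congr fun z => ?_
  exact map_smul (ofTensor E F) z.1 z.2

instance : PolynormableSpace ℂ (CompletedTensor E F) := by
  have : ContinuousSMul ℝ (CompletedTensor E F) := IsScalarTower.continuousSMul ℂ
  have : LocallyConvexSpace ℝ (CompletedTensor E F) := by
    rw [locallyConvexSpace_iff_exists_convex_subset_zero]
    intro U hU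
    obtain ⟨V, ⟨hV, hVc⟩, hVU⟩ := (closed_nhds_basis (0 : CompletedTensor E F)).mem_iff.1 hU
    have hV' : ofTensor E F ⁻¹' V ∈ 𝓝 0 :=
      (ofTensor E F).continuous.continuousAt.preimage_mem_nhds (by rwa [map_zero])
    obtain ⟨p, hp, hpV⟩ := exists_seminorm_ball_subset hV'
    refine ⟨closure (ofTensor E F '' p.ball 0 1), ?_, ?_, ?_⟩
    · have := (isDenseInducing_ofTensor E F).closure_image_mem_nhds
        (Seminorm.ball_mem_nhds hp one_pos)
      rwa [map_zero] at this
    · exact ((p.convex_ball 0 1).linear_image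
        ((ofTensor E F).toLinearMap.restrictScalars ℝ)).closure
    · refine (closure_minimal ?_ hVc).trans hVU
      rintro _ ⟨t, ht, rfl⟩
      exact hpV t (by simpa using ht)
  exact polynormableSpace_of_locallyConvex _

end basic

variable {E F : Type*} [AddCommGroup E] [Module ℂ E] [TopologicalSpace E]
  [AddCommGroup F] [Module ℂ F] [TopologicalSpace F]

/-- The elementary tensor `x ⊗ y`. -/
def tmul (x : E) (y : F) : CompletedTensor E F := ofTensor E F (ProjTensor.mk E F x y)

/-- The canonical bilinear map. -/
def mk (E F : Type*) [AddCommGroup E] [Module ℂ E] [TopologicalSpace E]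
    [AddCommGroup F] [Module ℂ F] [TopologicalSpace F] :
    E →ₗ[ℂ] F →ₗ[ℂ] CompletedTensor E F :=
  (ProjTensor.mk E F).compr₂ (ofTensor E F).toLinearMap

theorem mk_apply (x : E) (y : F) : mk E F x y = tmul x y := rfl

theorem continuous_mk [IsTopologicalAddGroup E] [IsTopologicalAddGroup F] :
    Continuous fun z : E × F => mk E F z.1 z.2 :=
  (ofTensor E F).continuous.comp ProjTensor.continuous_mk

/-- Continuous linear maps on `E ⊗̂ F` are determined by their values on elementary tensors. -/
theorem ext {G : Type*} [AddCommGroup G] [Module ℂ G] [TopologicalSpace G] [T2Space G]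
    {f g : CompletedTensor E F →L[ℂ] G} (h : ∀ x y, f (tmul x y) = g (tmul x y)) : f = g := by
  refine DFunLike.coe_injective ((isDenseInducing_ofTensor E F).dense.equalizer f.continuous
    g.continuous (funext fun t => ?_))
  change f (ofTensor E F t) = g (ofTensor E F t)
  induction t using ProjTensor.ind with
  | h0 => simp
  | hmk x y => exact h x y
  | hadd s t hs ht => simp only [map_add, hs, ht]

section lift

variable {G : Type*} [AddCommGroup G] [Module ℂ G] [UniformSpace G] [IsUniformAddGroup G]
  [PolynormableSpace ℂ G] [CompleteSpace G] [T2Space G]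

/-- The continuous linear map on `E ⊗̂ F` given by a jointly continuous bilinear map into a
complete locally convex space. -/
def lift (f : E →ₗ[ℂ] F →ₗ[ℂ] G) (hf : Continuous fun z : E × F => f z.1 z.2) :
    CompletedTensor E F →L[ℂ] G :=
  haveI := (PolynormableSpace.withSeminorms ℂ G).continuousSMul
  haveI : UniformContinuousConstSMul ℂ G := uniformContinuousConstSMul_of_continuousConstSMul ℂ G
  (ProjTensor.liftL f hf).fromCompletion

theorem lift_ofTensor (f : E →ₗ[ℂ] F →ₗ[ℂ] G) (hf : Continuous fun z : E × F => f z.1 z.2)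
    (t : ProjTensor E F) : lift f hf (ofTensor E F t) = ProjTensor.liftL f hf t := by
  have := (PolynormableSpace.withSeminorms ℂ G).continuousSMul
  have : UniformContinuousConstSMul ℂ G := uniformContinuousConstSMul_of_continuousConstSMul ℂ G
  exact ContinuousLinearMap.fromCompletion_apply_coe _ _

theorem lift_tmul (f : E →ₗ[ℂ] F →ₗ[ℂ] G) (hf : Continuous fun z : E × F => f z.1 z.2)
    (x : E) (y : F) : lift f hf (tmul x y) = f x y :=
  (lift_ofTensor f hf _).trans (ProjTensor.liftL_mk f hf x y)

variable {C : Type*} [AddCommGroup C] [Module ℂ C] [TopologicalSpace C]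

/-- A jointly continuous trilinear map `C × E × F → G` induces a bilinear map
`C × (E ⊗̂ F) → G`. -/
def lift₃ [ContinuousSMul ℂ G] (f : C →ₗ[ℂ] E →ₗ[ℂ] F →ₗ[ℂ] G)
    (hf : Continuous fun z : C × E × F => f z.1 z.2.1 z.2.2) :
    C →ₗ[ℂ] CompletedTensor E F →L[ℂ] G where
  toFun c := lift (f c) (hf.comp (Continuous.prodMk_right c))
  map_add' c d := ext fun x y => by simp [lift_tmul]
  map_smul' a c := ext fun x y => by simp [lift_tmul]

theorem lift₃_tmul [ContinuousSMul ℂ G] (f : C →ₗ[ℂ] E →ₗ[ℂ] F →ₗ[ℂ] G)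
    (hf : Continuous fun z : C × E × F => f z.1 z.2.1 z.2.2) (c : C) (x : E) (y : F) :
    lift₃ f hf c (tmul x y) = f c x y :=
  lift_tmul _ _ x y

theorem continuous_lift₃ [ContinuousSMul ℂ G] [PolynormableSpace ℂ C]
    [PolynormableSpace ℂ E] [PolynormableSpace ℂ F] (f : C →ₗ[ℂ] E →ₗ[ℂ] F →ₗ[ℂ] G)
    (hf : Continuous fun z : C × E × F => f z.1 z.2.1 z.2.2) :
    Continuous fun z : C × CompletedTensor E F => lift₃ f hf z.1 z.2 := by
  have := (PolynormableSpace.withSeminorms ℂ C).topologicalAddGroup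
  have := (PolynormableSpace.withSeminorms ℂ E).topologicalAddGroup
  have := (PolynormableSpace.withSeminorms ℂ F).topologicalAddGroup
  -- the bilinear map on the algebraic tensor product
  let b : C →ₗ[ℂ] ProjTensor E F →ₗ[ℂ] G :=
    (ContinuousLinearMap.coeLM ℂ ∘ₗ lift₃ f hf).compl₂ (ofTensor E F).toLinearMap
  have hbmk : ∀ c x y, b c (ProjTensor.mk E F x y) = f c x y := fun c x y => lift₃_tmul f hf c x y
  have hb : Continuous fun z : C × ProjTensor E F => b z.1 z.2 := by
    refine continuous_of_continuousAt_zero₂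
      (LinearMap.toAddMonoidHom'.comp b.toAddMonoidHom) ?_ (fun c => ?_) (fun t => ?_)
    · change ContinuousAt (fun z : C × ProjTensor E F => b z.1 z.2) (0, 0)
      rw [ContinuousAt, (PolynormableSpace.withSeminorms ℂ G).tendsto_nhds]
      intro R ε hε
      obtain ⟨s, p, q, hs, hp, hq, hbd⟩ := exists_seminorm_bound₃ f hf R.1 R.2
      obtain ⟨π, hπ, hmax⟩ := ProjTensor.exists_cross_seminorm p q
      have hπc : Continuous π := (ProjTensor.withSeminorms E F).continuous_seminorm
        ⟨π, ProjTensor.continuous_of_bound π hp hq hπ⟩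
      have h1 : ∀ c t, R.1 (b c t) ≤ s c * π t := fun c t =>
        hmax (R.1.comp (b c)) (s c) (apply_nonneg s c)
          (fun x y => by simpa [hbmk] using hbd c x y) t
      have h2 : Continuous fun z : C × ProjTensor E F => s z.1 * π z.2 := by fun_prop
      refine (h2.continuousAt.eventually_lt (continuousAt_const (y := ε)) ?_).mono fun z hz => ?_
      · simpa using hε
      · simpa using (h1 z.1 z.2).trans_lt hz
    · exact ((lift₃ f hf c).continuous.comp (ofTensor E F).continuous).continuousAt
    · change ContinuousAt (fun c => b c t) 0
      refine Continuous.continuousAt ?_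
      induction t using ProjTensor.ind with
      | h0 => simpa using continuous_const
      | hmk x y =>
        simp only [hbmk]
        exact hf.comp (Continuous.prodMk_left (x, y))
      | hadd s t hs ht =>
        simp only [map_add]
        exact Continuous.add hs ht
  exact continuous_of_ofTensor 
    (LinearMap.toAddMonoidHom'.comp (ContinuousLinearMap.coeLM ℂ ∘ₗ lift₃ f hf).toAddMonoidHom)
    (fun c => (lift₃ f hf c).continuous) hb

end lift

/-- The continuous linear map `f ⊗ g`. -/
def map {E' F' : Type*} [AddCommGroup E'] [Module ℂ E'] [TopologicalSpace E']
    [IsTopologicalAddGroup E'] [AddCommGroup F'] [Module ℂ F'] [TopologicalSpace F']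
    [IsTopologicalAddGroup F'] (f : E →L[ℂ] E') (g : F →L[ℂ] F') :
    CompletedTensor E F →L[ℂ] CompletedTensor E' F' :=
  lift ((mk E' F').compl₁₂ f.toLinearMap g.toLinearMap)
    (continuous_mk.comp (f := fun z : E × F => (f z.1, g z.2)) (by fun_prop))

theorem map_tmul {E' F' : Type*} [AddCommGroup E'] [Module ℂ E'] [TopologicalSpace E']
    [IsTopologicalAddGroup E'] [AddCommGroup F'] [Module ℂ F'] [TopologicalSpace F']
    [IsTopologicalAddGroup F'] (f : E →L[ℂ] E') (g : F →L[ℂ] F') (x : E) (y : F) :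
    map f g (tmul x y) = tmul (f x) (g y) :=
  lift_tmul _ _ x y

end CompletedTensor

/-! ## Noncommutative differential one-forms -/

section OneForms

variable (A : Type*) [Ring A] [Algebra ℂ A] [UniformSpace A] [FrechetAlgebra A]

namespace FrechetAlgebra

/-- The multiplication map `A ⊗̂ A → A`. -/
def mulMap : CompletedTensor A A →L[ℂ] A :=
  CompletedTensor.lift (LinearMap.mul ℂ A) continuous_mul

theorem mulMap_tmul (x y : A) : mulMap A (.tmul x y) = x * y :=
  CompletedTensor.lift_tmul _ _ x y

/-- The left action `a · (x ⊗ y) = a x ⊗ y` of `A` on `A ⊗̂ A`. -/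
def leftAct : A →ₗ[ℂ] CompletedTensor A A →L[ℂ] CompletedTensor A A :=
  CompletedTensor.lift₃
    (LinearMap.mk₂ ℂ (fun a x => CompletedTensor.mk A A (a * x))
      (fun a b x => by rw [add_mul, map_add])
      (fun c a x => by rw [smul_mul_assoc, map_smul])
      (fun a x y => by rw [mul_add, map_add])
      (fun c a x => by rw [mul_smul_comm, map_smul]))
    (CompletedTensor.continuous_mk.comp (f := fun z : A × A × A => (z.1 * z.2.1, z.2.2))
      (by fun_prop))

theorem leftAct_tmul (a x y : A) : leftAct A a (.tmul x y) = .tmul (a * x) y :=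
  CompletedTensor.lift₃_tmul _ _ a x y

theorem continuous_leftAct :
    Continuous fun z : A × CompletedTensor A A => leftAct A z.1 z.2 :=
  CompletedTensor.continuous_lift₃ _ _

/-- The right action `(x ⊗ y) · a = x ⊗ y a` of `A` on `A ⊗̂ A`. -/
def rightAct : A →ₗ[ℂ] CompletedTensor A A →L[ℂ] CompletedTensor A A :=
  CompletedTensor.lift₃
    (LinearMap.mk₂ ℂ (fun a x => CompletedTensor.mk A A x ∘ₗ LinearMap.mulRight ℂ a)
      (fun a b x => by ext y; simp [mul_add])
      (fun c a x => by ext y; simp)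
      (fun a x y => by ext z; simp)
      (fun c a x => by ext z; simp))
    (CompletedTensor.continuous_mk.comp (f := fun z : A × A × A => (z.2.1, z.2.2 * z.1))
      (by fun_prop))

theorem rightAct_tmul (a x y : A) : rightAct A a (.tmul x y) = .tmul x (y * a) :=
  CompletedTensor.lift₃_tmul _ _ a x y

theorem continuous_rightAct :
    Continuous fun z : A × CompletedTensor A A => rightAct A z.1 z.2 :=
  CompletedTensor.continuous_lift₃ _ _

variable {A}

theorem leftAct_one : leftAct A 1 = .id ℂ _ :=
  CompletedTensor.ext fun x y => by simp [leftAct_tmul]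

theorem leftAct_mul (a b : A) : leftAct A (a * b) = (leftAct A a).comp (leftAct A b) :=
  CompletedTensor.ext fun x y => by simp [leftAct_tmul, mul_assoc]

theorem rightAct_one : rightAct A 1 = .id ℂ _ :=
  CompletedTensor.ext fun x y => by simp [rightAct_tmul]

theorem rightAct_mul (a b : A) : rightAct A (a * b) = (rightAct A b).comp (rightAct A a) :=
  CompletedTensor.ext fun x y => by simp [rightAct_tmul, mul_assoc]

theorem leftAct_comp_rightAct (a b : A) :
    (leftAct A a).comp (rightAct A b) = (rightAct A b).comp (leftAct A a) :=
  CompletedTensor.ext fun x y => by simp [leftAct_tmul, rightAct_tmul]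

theorem mulMap_leftAct (a : A) (t : CompletedTensor A A) :
    mulMap A (leftAct A a t) = a * mulMap A t :=
  DFunLike.congr_fun (CompletedTensor.ext (f := (mulMap A).comp (leftAct A a))
    (g := (⟨LinearMap.mulLeft ℂ a, continuous_const.mul continuous_id⟩ : A →L[ℂ] A).comp (mulMap A))
    fun x y => by
      change mulMap A (leftAct A a (.tmul x y)) = a * mulMap A (.tmul x y)
      rw [leftAct_tmul, mulMap_tmul, mulMap_tmul, mul_assoc]) t

theorem mulMap_rightAct (a : A) (t : CompletedTensor A A) :
    mulMap A (rightAct A a t) = mulMap A t * a :=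
  DFunLike.congr_fun (CompletedTensor.ext (f := (mulMap A).comp (rightAct A a))
    (g := (⟨LinearMap.mulRight ℂ a, continuous_id.mul continuous_const⟩ : A →L[ℂ] A).comp (mulMap A))
    fun x y => by
      change mulMap A (rightAct A a (.tmul x y)) = mulMap A (.tmul x y) * a
      rw [rightAct_tmul, mulMap_tmul, mulMap_tmul, mul_assoc]) t

end FrechetAlgebra

open FrechetAlgebra

/-- The bimodule `Ω¹ A` of noncommutative differential one-forms: the kernel of the multiplication
map `A ⊗̂ A → A`. -/
def Omega : Type _ := LinearMap.ker (mulMap A).toLinearMap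

namespace Omega

instance : AddCommGroup (Omega A) :=
  inferInstanceAs (AddCommGroup (LinearMap.ker (mulMap A).toLinearMap))
instance : Module ℂ (Omega A) :=
  inferInstanceAs (Module ℂ (LinearMap.ker (mulMap A).toLinearMap))
instance : UniformSpace (Omega A) :=
  inferInstanceAs (UniformSpace (LinearMap.ker (mulMap A).toLinearMap))
instance : IsUniformAddGroup (Omega A) :=
  inferInstanceAs (IsUniformAddGroup (LinearMap.ker (mulMap A).toLinearMap).toAddSubgroup)
instance : ContinuousSMul ℂ (Omega A) :=
  inferInstanceAs (ContinuousSMul ℂ (LinearMap.ker (mulMap A).toLinearMap))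
instance : PolynormableSpace ℂ (Omega A) :=
  inferInstanceAs (PolynormableSpace ℂ (LinearMap.ker (mulMap A).toLinearMap))
instance : T2Space (Omega A) :=
  inferInstanceAs (T2Space (LinearMap.ker (mulMap A).toLinearMap))
instance : CompleteSpace (Omega A) :=
  ((isClosed_singleton (x := (0 : A))).preimage (mulMap A).continuous).completeSpace_coe

/-- The inclusion `j_A : Ω¹ A → A ⊗̂ A`. -/
def incl : Omega A →L[ℂ] CompletedTensor A A :=
  (LinearMap.ker (mulMap A).toLinearMap).subtypeL

variable {A}

theorem incl_injective : Function.Injective (incl A) := Subtype.val_injective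

theorem isInducing_incl : Topology.IsInducing (incl A) := Topology.IsInducing.subtypeVal

theorem mulMap_incl (ω : Omega A) : mulMap A (incl A ω) = 0 := ω.2

/-- The left action on one-forms, inherited from `a · (x ⊗ y) = a x ⊗ y`. -/
instance : SMul A (Omega A) where
  smul a ω := ⟨leftAct A a (incl A ω), by
    change mulMap A _ = 0
    rw [mulMap_leftAct, mulMap_incl, mul_zero]⟩

/-- The right action on one-forms, inherited from `(x ⊗ y) · a = x ⊗ y a`. -/
instance : SMul Aᵐᵒᵖ (Omega A) where
  smul a ω := ⟨rightAct A a.unop (incl A ω), by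
    change mulMap A _ = 0
    rw [mulMap_rightAct, mulMap_incl, zero_mul]⟩

theorem incl_smul (a : A) (ω : Omega A) : incl A (a • ω) = leftAct A a (incl A ω) := rfl

theorem incl_op_smul (a : Aᵐᵒᵖ) (ω : Omega A) :
    incl A (a • ω) = rightAct A a.unop (incl A ω) := rfl

instance : Module A (Omega A) where
  one_smul ω := incl_injective (by rw [incl_smul, leftAct_one]; rfl)
  mul_smul a b ω := incl_injective (by simp only [incl_smul, leftAct_mul]; rfl)
  smul_zero a := incl_injective (by simp only [incl_smul, map_zero])
  smul_add a ω η := incl_injective (by simp only [incl_smul, map_add])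
  add_smul a b ω := incl_injective (by
    simp only [incl_smul, map_add, _root_.add_apply])
  zero_smul ω := incl_injective (by
    simp only [incl_smul, map_zero, _root_.zero_apply])

instance : Module Aᵐᵒᵖ (Omega A) where
  one_smul ω := incl_injective (by rw [incl_op_smul, unop_one, rightAct_one]; rfl)
  mul_smul a b ω := incl_injective (by simp only [incl_op_smul, unop_mul, rightAct_mul]; rfl)
  smul_zero a := incl_injective (by simp only [incl_op_smul, map_zero])
  smul_add a ω η := incl_injective (by simp only [incl_op_smul, map_add])
  add_smul a b ω := incl_injective (by
    rw [map_add, incl_op_smul, incl_op_smul, incl_op_smul, MulOpposite.unop_add, map_add]; rfl)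
  zero_smul ω := incl_injective (by
    simp only [incl_op_smul, unop_zero, map_zero, _root_.zero_apply])

instance : ContinuousBimodule A (Omega A) where
  smul_assoc c a ω := incl_injective (by
    simp only [incl_smul, map_smul, _root_.smul_apply])
  isScalarTower_op := ⟨fun c a ω => incl_injective (by
    simp only [incl_op_smul, unop_smul, map_smul, _root_.smul_apply])⟩
  smul_comm a b ω := incl_injective (by
    exact DFunLike.congr_fun (leftAct_comp_rightAct a b.unop) (incl A ω))
  continuous_smul := isInducing_incl.continuous_iff.2
    ((continuous_leftAct A).comp (f := fun z : A × Omega A => (z.1, incl A z.2)) (by fun_prop))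
  continuousSMul_op := ⟨isInducing_incl.continuous_iff.2
    ((continuous_rightAct A).comp (f := fun z : Aᵐᵒᵖ × Omega A => (z.1.unop, incl A z.2))
      (by fun_prop))⟩

variable {B : Type*} [Ring B] [Algebra ℂ B] [UniformSpace B] [FrechetAlgebra B]

theorem mulMap_map (φ : A →A[ℂ] B) (t : CompletedTensor A A) :
    mulMap B (CompletedTensor.map φ.toContinuousLinearMap φ.toContinuousLinearMap t) = φ (mulMap A t) :=
  DFunLike.congr_fun (CompletedTensor.ext
    (f := (mulMap B).comp (CompletedTensor.map φ.toContinuousLinearMap φ.toContinuousLinearMap))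
    (g := φ.toContinuousLinearMap.comp (mulMap A))
    fun x y => by simp [CompletedTensor.map_tmul, mulMap_tmul]) t

/-- The map `Ω¹ A → Ω¹ B` induced by `φ`, i.e. the restriction of `φ ⊗̂ φ`. -/
def map (φ : A →A[ℂ] B) : Omega A →L[ℂ] Omega B :=
  ((CompletedTensor.map φ.toContinuousLinearMap φ.toContinuousLinearMap).comp (incl A)).codRestrict
    (LinearMap.ker (mulMap B).toLinearMap) (fun ω => by
      change mulMap B (CompletedTensor.map φ.toContinuousLinearMap φ.toContinuousLinearMap (incl A ω)) = 0
      rw [mulMap_map, mulMap_incl, map_zero])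

theorem incl_map (φ : A →A[ℂ] B) (ω : Omega A) :
    incl B (map φ ω) = CompletedTensor.map φ.toContinuousLinearMap φ.toContinuousLinearMap (incl A ω) := rfl

theorem map_smul (φ : A →A[ℂ] B) (a : A) (ω : Omega A) : map φ (a • ω) = φ a • map φ ω :=
  incl_injective (DFunLike.congr_fun (CompletedTensor.ext
    (f := (CompletedTensor.map φ.toContinuousLinearMap φ.toContinuousLinearMap).comp (leftAct A a))
    (g := (leftAct B (φ a)).comp (CompletedTensor.map φ.toContinuousLinearMap φ.toContinuousLinearMap))
    fun x y => by simp [CompletedTensor.map_tmul, leftAct_tmul]) (incl A ω))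

theorem map_op_smul (φ : A →A[ℂ] B) (a : Aᵐᵒᵖ) (ω : Omega A) :
    map φ (a • ω) = op (φ a.unop) • map φ ω :=
  incl_injective (DFunLike.congr_fun (CompletedTensor.ext
    (f := (CompletedTensor.map φ.toContinuousLinearMap φ.toContinuousLinearMap).comp (rightAct A a.unop))
    (g := (rightAct B (φ a.unop)).comp (CompletedTensor.map φ.toContinuousLinearMap φ.toContinuousLinearMap))
    fun x y => by simp [CompletedTensor.map_tmul, rightAct_tmul]) (incl A ω))

end Omega

end OneForms

/-! ## Restriction of scalars and derivations -/

section Restrict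

variable {A B : Type*} [Ring A] [Algebra ℂ A] [UniformSpace A] [FrechetAlgebra A]
  [Ring B] [Algebra ℂ B] [UniformSpace B] [FrechetAlgebra B]

/-- A `B`-bimodule `M` regarded as an `A`-bimodule along `φ : A → B`. -/
def Restrict (_ : A →A[ℂ] B) (M : Type*) : Type _ := M

namespace Restrict

variable (φ : A →A[ℂ] B) (M : Type*) [AddCommGroup M] [Module ℂ M] [UniformSpace M]

instance : AddCommGroup (Restrict φ M) := inferInstanceAs (AddCommGroup M)
instance : Module ℂ (Restrict φ M) := inferInstanceAs (Module ℂ M)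
instance : UniformSpace (Restrict φ M) := inferInstanceAs (UniformSpace M)
instance [FrechetSpace M] : FrechetSpace (Restrict φ M) := inferInstanceAs (FrechetSpace M)

/-- The identity map. -/
def equiv : Restrict φ M ≃L[ℂ] M := ContinuousLinearEquiv.refl ℂ M

/-- The left action `a · x = φ(a) x`. -/
instance [Module B M] : Module A (Restrict φ M) := Module.compHom M (φ : A →+* B)

/-- The right action `x · a = x φ(a)`. -/
instance [Module Bᵐᵒᵖ M] : Module Aᵐᵒᵖ (Restrict φ M) := Module.compHom M (RingHom.op (φ : A →+* B))

variable {M}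

theorem equiv_smul [Module B M] (a : A) (x : Restrict φ M) :
    equiv φ M (a • x) = φ a • equiv φ M x := rfl

theorem equiv_op_smul [Module Bᵐᵒᵖ M] (a : Aᵐᵒᵖ) (x : Restrict φ M) :
    equiv φ M (a • x) = op (φ a.unop) • equiv φ M x := rfl

variable (M) in
instance [Module B M] [Module Bᵐᵒᵖ M] [ContinuousBimodule B M] :
    ContinuousBimodule A (Restrict φ M) where
  smul_assoc c a x := (equiv φ M).injective (by
    simp only [equiv_smul, map_smul, smul_assoc])
  isScalarTower_op := ⟨fun c a x => (equiv φ M).injective (by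
    simp only [equiv_op_smul, map_smul, unop_smul, op_smul, smul_assoc])⟩
  smul_comm a b x := (equiv φ M).injective (by
    simp only [equiv_smul, equiv_op_smul, smul_comm])
  continuous_smul := by
    have h : Continuous fun z : A × Restrict φ M => φ z.1 • equiv φ M z.2 :=
      (φ.continuous.comp continuous_fst).smul ((equiv φ M).continuous.comp continuous_snd)
    exact h
  continuousSMul_op := ⟨by
    have h : Continuous fun z : Aᵐᵒᵖ × Restrict φ M => op (φ z.1.unop) • equiv φ M z.2 :=
      (continuous_op.comp (φ.continuous.comp (continuous_unop.comp continuous_fst))).smul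
        ((equiv φ M).continuous.comp continuous_snd)
    exact h⟩

end Restrict

/-- The space `Der(A, M)` of continuous derivations from `A` to a Fréchet `A`-bimodule `M`. -/
def Der (A M : Type*) [Ring A] [Algebra ℂ A] [UniformSpace A] [FrechetAlgebra A]
    [AddCommGroup M] [Module ℂ M] [UniformSpace M] [FrechetSpace M]
    [Module A M] [Module Aᵐᵒᵖ M] [ContinuousBimodule A M] : Submodule ℂ (A →L[ℂ] M) where
  carrier := {D | ∀ a b : A, D (a * b) = a • D b + op b • D a}
  zero_mem' a b := by simp
  add_mem' {D E} hD hE a b := by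
    simp only [_root_.add_apply, hD a b, hE a b, smul_add]
    abel
  smul_mem' c D hD a b := by
    simp only [_root_.smul_apply, hD a b, smul_add]
    rw [smul_algebra_smul_comm c a, smul_algebra_smul_comm c (op b)]

/-- The restriction map `Der(B, X) → Der(A, X)`, `D ↦ D ∘ φ`. -/
def Der.restrict (φ : A →A[ℂ] B) (X : Type*) [AddCommGroup X] [Module ℂ X] [UniformSpace X]
    [FrechetSpace X] [Module B X] [Module Bᵐᵒᵖ X] [ContinuousBimodule B X] :
    Der B X →ₗ[ℂ] Der A (Restrict φ X) where
  toFun D := ⟨((Restrict.equiv φ X).symm : X →L[ℂ] Restrict φ X).comp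
      (D.1.comp φ.toContinuousLinearMap), fun a b => by
    refine (Restrict.equiv φ X).injective ?_
    change D.1 (φ (a * b)) = φ a • D.1 (φ b) + op (φ b) • D.1 (φ a)
    rw [map_mul, D.2]⟩
  map_add' _ _ := rfl
  map_smul' _ _ := rfl

end Restrict

/-! ## Tensor products of Fréchet modules -/

section ModTensor

open CompletedTensor

variable (A M N : Type*) [Ring A] [AddCommGroup M] [Module ℂ M] [TopologicalSpace M]
  [Module Aᵐᵒᵖ M] [AddCommGroup N] [Module ℂ N] [TopologicalSpace N] [Module A N]

/-- The closed linear span in `M ⊗̂ N` of all elements `x a ⊗ y - x ⊗ a y`. -/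
def balancedSubmodule : Submodule ℂ (CompletedTensor M N) :=
  (Submodule.span ℂ {t | ∃ (x : M) (a : A) (y : N),
    t = tmul (op a • x) y - tmul x (a • y)}).topologicalClosure

/-- The tensor product `M ⊗̂_A N` of a right `A`-module `M` and a left `A`-module `N`. -/
def ModTensor : Type _ := CompletedTensor M N ⧸ balancedSubmodule A M N

namespace ModTensor

instance : AddCommGroup (ModTensor A M N) :=
  inferInstanceAs (AddCommGroup (CompletedTensor M N ⧸ balancedSubmodule A M N))
instance : Module ℂ (ModTensor A M N) :=
  inferInstanceAs (Module ℂ (CompletedTensor M N ⧸ balancedSubmodule A M N))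
instance : TopologicalSpace (ModTensor A M N) :=
  inferInstanceAs (TopologicalSpace (CompletedTensor M N ⧸ balancedSubmodule A M N))
instance : IsTopologicalAddGroup (ModTensor A M N) :=
  inferInstanceAs (IsTopologicalAddGroup (CompletedTensor M N ⧸ balancedSubmodule A M N))
instance : ContinuousSMul ℂ (ModTensor A M N) :=
  inferInstanceAs (ContinuousSMul ℂ (CompletedTensor M N ⧸ balancedSubmodule A M N))
instance : T2Space (ModTensor A M N) :=
  haveI : IsClosed (balancedSubmodule A M N : Set (CompletedTensor M N)) :=
    Submodule.isClosed_topologicalClosure _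
  inferInstanceAs (T2Space (CompletedTensor M N ⧸ balancedSubmodule A M N))

/-- The quotient map `M ⊗̂ N → M ⊗̂_A N`. -/
def proj : CompletedTensor M N →L[ℂ] ModTensor A M N := (balancedSubmodule A M N).mkQL

theorem proj_surjective : Function.Surjective (proj A M N) := Submodule.mkQ_surjective _

variable {M N}

/-- The elementary tensor `x ⊗_A y`. -/
def tmul (x : M) (y : N) : ModTensor A M N := proj A M N (CompletedTensor.tmul x y)

variable {A}

theorem tmul_add (x : M) (y z : N) : tmul A x (y + z) = tmul A x y + tmul A x z := by
  change proj A M N (CompletedTensor.mk M N x (y + z)) = _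
  rw [map_add, map_add]
  rfl

theorem tmul_zero (x : M) : tmul A x (0 : N) = 0 := by
  change proj A M N (CompletedTensor.mk M N x 0) = _
  rw [map_zero, map_zero]

theorem tmul_balanced (x : M) (a : A) (y : N) : tmul A (op a • x) y = tmul A x (a • y) := by
  refine sub_eq_zero.1 ?_
  rw [tmul, tmul, ← map_sub]
  exact (Submodule.Quotient.mk_eq_zero _).2
    (Submodule.le_topologicalClosure _ (Submodule.subset_span ⟨x, a, y, rfl⟩))

/-- Continuous linear maps on `M ⊗̂_A N` are determined by their values on elementary tensors. -/
theorem ext {G : Type*} [AddCommGroup G] [Module ℂ G] [TopologicalSpace G] [T2Space G]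
    {f g : ModTensor A M N →L[ℂ] G} (h : ∀ x y, f (tmul A x y) = g (tmul A x y)) : f = g := by
  have h1 : f.comp (proj A M N) = g.comp (proj A M N) := CompletedTensor.ext h
  ext t
  obtain ⟨t, rfl⟩ := proj_surjective A M N t
  exact DFunLike.congr_fun h1 t

/-- The map on `M ⊗̂_A N` induced by a balanced continuous linear map on `M ⊗̂ N`. -/
def desc {G : Type*} [AddCommGroup G] [Module ℂ G] [TopologicalSpace G] [T2Space G]
    (f : CompletedTensor M N →L[ℂ] G)
    (hf : ∀ (x : M) (a : A) (y : N),
      f (CompletedTensor.tmul (op a • x) y) = f (CompletedTensor.tmul x (a • y))) :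
    ModTensor A M N →L[ℂ] G :=
  (balancedSubmodule A M N).liftQL f (Submodule.topologicalClosure_minimal _
    (Submodule.span_le.2 (by
      rintro _ ⟨x, a, y, rfl⟩
      change f (_ - _) = 0
      rw [map_sub, hf, sub_self])) (isClosed_singleton.preimage f.continuous))

theorem desc_tmul {G : Type*} [AddCommGroup G] [Module ℂ G] [TopologicalSpace G] [T2Space G]
    (f : CompletedTensor M N →L[ℂ] G)
    (hf : ∀ (x : M) (a : A) (y : N),
      f (CompletedTensor.tmul (op a • x) y) = f (CompletedTensor.tmul x (a • y))) (x : M) (y : N) :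
    desc f hf (tmul A x y) = f (CompletedTensor.tmul x y) := rfl

section rightModule

variable [Algebra ℂ A] [TopologicalSpace A] [IsTopologicalAddGroup M] [IsTopologicalAddGroup N]
  [Module Aᵐᵒᵖ N] [ContinuousBimodule A N]

/-- The right action of an element of `A` on a bimodule as a continuous linear map. -/
def opSMul (a : Aᵐᵒᵖ) : N →L[ℂ] N where
  toFun y := a • y
  map_add' := smul_add a
  map_smul' c y := (smul_algebra_smul_comm c a y)
  cont := continuous_const_smul a

/-- The right action `(x ⊗ y) · a = x ⊗ y a` on `M ⊗̂_A N`, for an `A`-bimodule `N`. -/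
def rightAct (a : Aᵐᵒᵖ) : ModTensor A M N →L[ℂ] ModTensor A M N :=
  desc ((proj A M N).comp (CompletedTensor.map (.id ℂ M) (opSMul a))) (fun x b y => by
    change proj A M N (CompletedTensor.map _ _ _) = proj A M N (CompletedTensor.map _ _ _)
    rw [CompletedTensor.map_tmul, CompletedTensor.map_tmul]
    refine (tmul_balanced x b (a • y)).trans ?_
    rw [smul_comm b a y]
    rfl)

theorem rightAct_tmul (a : Aᵐᵒᵖ) (x : M) (y : N) :
    rightAct a (tmul A x y) = tmul A x (a • y) := by
  change proj A M N (CompletedTensor.map _ _ _) = _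
  rw [CompletedTensor.map_tmul]
  rfl

instance : Module Aᵐᵒᵖ (ModTensor A M N) where
  smul a t := rightAct a t
  one_smul t := DFunLike.congr_fun (ext (f := rightAct 1) (g := .id ℂ _)
    fun x y => by simp [rightAct_tmul]) t
  mul_smul a b t := DFunLike.congr_fun (ext (f := rightAct (a * b))
    (g := (rightAct a).comp (rightAct b)) fun x y => by simp [rightAct_tmul, mul_smul]) t
  smul_zero a := map_zero (rightAct a)
  smul_add a := map_add (rightAct a)
  add_smul a b t := DFunLike.congr_fun (ext (f := rightAct (a + b))
    (g := rightAct a + rightAct b) fun x y => by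
      simp [rightAct_tmul, add_smul, tmul_add]) t
  zero_smul t := DFunLike.congr_fun (ext (f := rightAct 0) (g := 0)
    fun x y => by simp [rightAct_tmul, tmul_zero]) t

theorem op_smul_tmul (a : Aᵐᵒᵖ) (x : M) (y : N) : a • tmul A x y = tmul A x (a • y) :=
  rightAct_tmul a x y

end rightModule

end ModTensor

end ModTensor

/-! ## The canonical map `B ⊗̂_A Ω¹ A ⊗̂_A B → Ω¹ B` -/

section CanonicalMap

variable {A B : Type*} [Ring A] [Algebra ℂ A] [UniformSpace A] [FrechetAlgebra A]
  [Ring B] [Algebra ℂ B] [UniformSpace B] [FrechetAlgebra B] (φ : A →A[ℂ] B)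

/-- The bilinear map `(b, ω) ↦ b · (φ ⊗̂ φ)(ω)`. -/
def leftBilin : Restrict φ B →ₗ[ℂ] Omega A →ₗ[ℂ] Omega B :=
  LinearMap.mk₂ ℂ (fun b ω => Restrict.equiv φ B b • Omega.map φ ω)
    (fun b c ω => by rw [map_add, add_smul])
    (fun z b ω => by rw [map_smul, smul_assoc])
    (fun b ω η => by rw [map_add, smul_add])
    (fun z b ω => by rw [map_smul, smul_algebra_smul_comm])

theorem leftBilin_apply (b : Restrict φ B) (ω : Omega A) :
    leftBilin φ b ω = Restrict.equiv φ B b • Omega.map φ ω := rfl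

theorem continuous_leftBilin :
    Continuous fun z : Restrict φ B × Omega A => leftBilin φ z.1 z.2 := by
  have h : Continuous fun z : Restrict φ B × Omega A =>
      Restrict.equiv φ B z.1 • Omega.map φ z.2 :=
    ((Restrict.equiv φ B).continuous.comp continuous_fst).smul
      ((Omega.map φ).continuous.comp continuous_snd)
  exact h

/-- The map `B ⊗̂_A Ω¹ A → Ω¹ B`, `b ⊗ ω ↦ b · (φ ⊗̂ φ)(ω)`. -/
def leftCanonicalMap : ModTensor A (Restrict φ B) (Omega A) →L[ℂ] Omega B :=
  ModTensor.desc (CompletedTensor.lift (leftBilin φ) (continuous_leftBilin φ)) (fun b a ω => by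
    rw [CompletedTensor.lift_tmul, CompletedTensor.lift_tmul, leftBilin_apply, leftBilin_apply,
      Omega.map_smul, Restrict.equiv_op_smul, op_smul_eq_mul, mul_smul]
    rfl)

theorem leftCanonicalMap_tmul (b : Restrict φ B) (ω : Omega A) :
    leftCanonicalMap φ (.tmul A b ω) = Restrict.equiv φ B b • Omega.map φ ω :=
  CompletedTensor.lift_tmul _ _ b ω

theorem leftCanonicalMap_op_smul (a : Aᵐᵒᵖ) (t : ModTensor A (Restrict φ B) (Omega A)) :
    leftCanonicalMap φ (a • t) = op (φ a.unop) • leftCanonicalMap φ t :=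
  DFunLike.congr_fun (ModTensor.ext
    (f := (leftCanonicalMap φ).comp (ModTensor.rightAct a))
    (g := (ModTensor.opSMul (op (φ a.unop))).comp (leftCanonicalMap φ)) fun b ω => by
      change leftCanonicalMap φ (ModTensor.rightAct a (.tmul A b ω)) =
        op (φ a.unop) • leftCanonicalMap φ (.tmul A b ω)
      rw [ModTensor.rightAct_tmul, leftCanonicalMap_tmul, leftCanonicalMap_tmul,
        Omega.map_op_smul, smul_comm]) t

/-- The triple tensor product `B ⊗̂_A Ω¹ A ⊗̂_A B`. -/
abbrev OmegaBaseChange : Type _ :=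
  ModTensor A (ModTensor A (Restrict φ B) (Omega A)) (Restrict φ B)

/-- The bilinear map `(t, b') ↦ t · b'`. -/
def rightBilin : ModTensor A (Restrict φ B) (Omega A) →ₗ[ℂ] Restrict φ B →ₗ[ℂ] Omega B :=
  LinearMap.mk₂ ℂ (fun t b => op (Restrict.equiv φ B b) • leftCanonicalMap φ t)
    (fun t u b => by rw [map_add, smul_add])
    (fun z t b => by rw [map_smul, smul_algebra_smul_comm])
    (fun t b c => by rw [map_add, MulOpposite.op_add, add_smul])
    (fun z t b => by rw [map_smul, op_smul, smul_assoc])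

theorem rightBilin_apply (t : ModTensor A (Restrict φ B) (Omega A)) (b : Restrict φ B) :
    rightBilin φ t b = op (Restrict.equiv φ B b) • leftCanonicalMap φ t := rfl

theorem continuous_rightBilin :
    Continuous fun z : ModTensor A (Restrict φ B) (Omega A) × Restrict φ B =>
      rightBilin φ z.1 z.2 := by
  have h : Continuous fun z : ModTensor A (Restrict φ B) (Omega A) × Restrict φ B =>
      op (Restrict.equiv φ B z.2) • leftCanonicalMap φ z.1 :=
    (continuous_op.comp ((Restrict.equiv φ B).continuous.comp continuous_snd)).smul
      ((leftCanonicalMap φ).continuous.comp continuous_fst)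
  exact h

/-- The canonical map `B ⊗̂_A Ω¹ A ⊗̂_A B → Ω¹ B`, `b ⊗ ω ⊗ b' ↦ b · (φ ⊗̂ φ)(ω) · b'`. -/
def canonicalMap : OmegaBaseChange φ →L[ℂ] Omega B :=
  ModTensor.desc (CompletedTensor.lift (rightBilin φ) (continuous_rightBilin φ)) (fun t a b => by
    rw [CompletedTensor.lift_tmul, CompletedTensor.lift_tmul, rightBilin_apply, rightBilin_apply,
      leftCanonicalMap_op_smul, Restrict.equiv_smul, smul_eq_mul, op_mul, mul_smul]
    rfl)

/-- The value of the canonical map on elementary tensors, inside `B ⊗̂ B`. -/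
theorem incl_canonicalMap_tmul (b b' : Restrict φ B) (ω : Omega A) :
    Omega.incl B (canonicalMap φ (.tmul A (.tmul A b ω) b')) =
      FrechetAlgebra.rightAct B (Restrict.equiv φ B b')
        (FrechetAlgebra.leftAct B (Restrict.equiv φ B b)
          (CompletedTensor.map φ.toContinuousLinearMap φ.toContinuousLinearMap
            (Omega.incl A ω))) := by
  have h : canonicalMap φ (.tmul A (.tmul A b ω) b') =
      op (Restrict.equiv φ B b') • leftCanonicalMap φ (.tmul A b ω) :=
    CompletedTensor.lift_tmul _ _ _ _
  rw [h, leftCanonicalMap_tmul]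
  rfl

end CanonicalMap

end

noncomputable section

/-! ## Metrizability of the completed projective tensor product -/

/-! Both links of the equivalence pass through derivations, so condition (ii) is the hub.

(i) ⇔ (ii). A derivation `D : B → X` is the same as a homomorphism `b ↦ (b, D b)` from `B` to the
trivial extension `B ⊕ X`, which is again a Fréchet algebra (`Der.toTrivSqZeroExt`). Two derivations
agreeing on `φ(A)` give two homomorphisms agreeing on `φ(A)`, and an epimorphism cannot tell them
apart. Conversely, two homomorphisms `g, h : B → C` make `C` a `B`-bimodule, with `g` on the left
and `h` on the right, and `g - h` is then a derivation (`TwoSided.subDer`). It vanishes on `φ(A)` if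
`gφ = hφ`, so (ii) forces `g = h`.

(ii) ⇔ (iii). Every `D : B → X` factors as `D = f ∘ d`, where `d b = 1 ⊗ b - b ⊗ 1` is the universal
derivation and `f : Ω¹B → X` is the continuous bimodule morphism obtained by restricting `x ⊗ y ↦ x
D(y)` (`Der.omegaMap`). If `D` vanishes on `φ(A)`, then `f` kills the image of the canonical map;
when that image is dense, `f = 0` and hence `D = 0`. Conversely, let `N` be the closed subbimodule
of `Ω¹B` generated by the image of `Ω¹A`. The class of `d` in `Ω¹B / N` is a derivation that
vanishes on `φ(A)`, because `d (φ a)` is the image of `d a`. By (ii) it is zero, so `N` contains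
every `x · d y`. The map `x ⊗ y ↦ x · d y` restricts to the identity on `Ω¹B`
(`Der.omegaMap_omega_d`), so `N` is all of `Ω¹B`; and `N` lies in the closure of the range of the
canonical map.

The analytic cost sits in the last argument: (ii) speaks only of Fréchet bimodules, so `Ω¹B / N` has
to be one. This requires metrizability of `B ⊗̂ B`, then the passage to a closed subspace and to a
quotient. Metrizability also gives completeness of the quotient. -/

/-- In a first countable locally convex space, a sequence of continuous seminorms dominates all
continuous seminorms. -/
theorem exists_seq_seminorm_dominating (E : Type*) [AddCommGroup E] [Module ℂ E]
    [TopologicalSpace E] [PolynormableSpace ℂ E] [FirstCountableTopology E] :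
    ∃ p : ℕ → Seminorm ℂ E, (∀ n, Continuous (p n)) ∧
      ∀ r : Seminorm ℂ E, Continuous r → ∃ n, r ≤ p n := by
  obtain ⟨U, hU⟩ := (𝓝 (0 : E)).exists_antitone_basis
  choose p hp hpU using fun n => exists_seminorm_ball_subset (hU.1.mem_of_mem (i := n) trivial)
  refine ⟨p, hp, fun r hr => ?_⟩
  have h0 : {x | r x < 1} ∈ 𝓝 (0 : E) :=
    hr.continuousAt.eventually_lt continuousAt_const (by simp)
  obtain ⟨n, -, hn⟩ := hU.1.mem_iff.1 h0
  -- Homogeneity turns the inclusion of unit balls into `r ≤ p n`, with no extra constant. The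
  -- scaling is by an arbitrary `a > p n x`, since `p n x` itself may be zero.
  refine ⟨n, fun x => le_of_forall_gt fun a ha => ?_⟩
  have ha0 : 0 < a := (apply_nonneg (p n) x).trans_lt ha
  have h1 : r ((a⁻¹ : ℂ) • x) < 1 := hn (hpU n _ (seminorm_inv_smul_lt_one (p n) x a ha))
  rwa [map_smul_eq_mul, norm_inv, Complex.norm_real, Real.norm_of_nonneg ha0.le,
    inv_mul_lt_iff₀ ha0, mul_one] at h1

/-- A seminorm which is continuous on elementary tensors is bounded there by a product of
continuous seminorms. -/
theorem ProjTensor.exists_bound {E F : Type*} [AddCommGroup E] [Module ℂ E] [TopologicalSpace E]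
    [PolynormableSpace ℂ E] [AddCommGroup F] [Module ℂ F] [TopologicalSpace F]
    [PolynormableSpace ℂ F] (r : Seminorm ℂ (ProjTensor E F)) (hr : Continuous r) :
    ∃ (p : Seminorm ℂ E) (q : Seminorm ℂ F), Continuous p ∧ Continuous q ∧
      ∀ x y, r (mk E F x y) ≤ p x * q y := by
  have := (PolynormableSpace.withSeminorms ℂ E).topologicalAddGroup
  have := (PolynormableSpace.withSeminorms ℂ F).topologicalAddGroup
  -- The trilinear estimate is applied to `(c, x, y) ↦ c • (x ⊗ y)`. Setting `c = 1` gives the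
  -- bilinear one, and the factor `s 1` is absorbed into `p`.
  obtain ⟨s, p, q, -, hp, hq, h⟩ := exists_seminorm_bound₃
    ((LinearMap.lsmul ℂ (E →ₗ[ℂ] F →ₗ[ℂ] ProjTensor E F)).flip (mk E F))
    (continuous_fst.smul (continuous_mk.comp continuous_snd)) r hr
  refine ⟨(s 1).toNNReal • p, q, continuous_const.mul hp, hq, fun x y => ?_⟩
  have h1 := h 1 x y
  simp only [LinearMap.flip_apply, LinearMap.lsmul_apply, one_smul] at h1
  change _ ≤ ((s 1).toNNReal : ℝ) * p x * q y
  rwa [Real.coe_toNNReal _ (apply_nonneg s 1), mul_assoc]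

/-- Countably many seminorms suffice: the largest cross seminorms of `p m` and `q n`, for dominating
sequences `p` and `q`. A continuous seminorm is bounded on elementary tensors by some `p m x * q n
y`, and maximality of the cross seminorm carries this bound to all tensors. -/
instance ProjTensor.firstCountableTopology (E F : Type*) [AddCommGroup E] [Module ℂ E]
    [TopologicalSpace E] [PolynormableSpace ℂ E] [FirstCountableTopology E] [AddCommGroup F]
    [Module ℂ F] [TopologicalSpace F] [PolynormableSpace ℂ F] [FirstCountableTopology F] :
    FirstCountableTopology (ProjTensor E F) := by
  have := (PolynormableSpace.withSeminorms ℂ E).topologicalAddGroup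
  have := (PolynormableSpace.withSeminorms ℂ F).topologicalAddGroup
  obtain ⟨p, hp, hpd⟩ := exists_seq_seminorm_dominating E
  obtain ⟨q, hq, hqd⟩ := exists_seq_seminorm_dominating F
  choose c hc hmax using fun i : ℕ × ℕ => exists_cross_seminorm (p i.1) (q i.2)
  have hw : WithSeminorms (c : SeminormFamily ℂ (ProjTensor E F) (ℕ × ℕ)) := by
    -- Each family must be bounded by the other. Each `c i` is itself one of the defining seminorms;
    -- each defining seminorm lies below a single `c (m, n)`.
    refine (withSeminorms E F).congr (fun i => ?_) (fun r => ?_)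
    · refine ⟨{⟨c i, continuous_of_bound (c i) (hp i.1) (hq i.2) (hc i)⟩}, 1, ?_⟩
      rw [Finset.sup_singleton, one_smul]
      exact le_rfl
    · obtain ⟨s, t, hs, ht, h⟩ := exists_bound r.1 ((withSeminorms E F).continuous_seminorm r)
      obtain ⟨m, hm⟩ := hpd s hs
      obtain ⟨n, hn⟩ := hqd t ht
      refine ⟨{(m, n)}, 1, fun z => ?_⟩
      rw [Finset.sup_singleton, one_smul]
      refine (hmax (m, n) r.1 1 zero_le_one (fun x y => ?_) z).trans (one_mul _).le
      rw [one_mul]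
      exact (h x y).trans (mul_le_mul (hm x) (hn y) (apply_nonneg _ _) (apply_nonneg _ _))
  exact hw.firstCountableTopology

/-- Only metrizability needs an argument: a Hausdorff uniform group with a countable basis at zero
is metrizable, and such a basis is inherited from the dense algebraic tensor product. -/
instance CompletedTensor.frechetSpace (E F : Type*) [AddCommGroup E] [Module ℂ E]
    [TopologicalSpace E] [PolynormableSpace ℂ E] [FirstCountableTopology E] [AddCommGroup F]
    [Module ℂ F] [TopologicalSpace F] [PolynormableSpace ℂ F] [FirstCountableTopology F] :
    FrechetSpace (CompletedTensor E F) := by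
  have hc : (𝓝 (0 : CompletedTensor E F)).IsCountablyGenerated := by
    obtain ⟨U, hU⟩ := (𝓝 (0 : ProjTensor E F)).exists_antitone_basis
    -- The closures of the images of a basis at zero form a basis at zero of the completion, which
    -- is a regular space.
    have h := hU.1.hasBasis_of_isDenseInducing (isDenseInducing_ofTensor E F)
    rw [map_zero] at h
    exact Filter.HasCountableBasis.isCountablyGenerated ⟨h, Set.to_countable _⟩
  have : (uniformity (CompletedTensor E F)).IsCountablyGenerated :=
    IsUniformAddGroup.uniformity_countably_generated
  have : ContinuousSMul ℝ (CompletedTensor E F) := IsScalarTower.continuousSMul ℂ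
  exact
    { toLocallyConvexSpace :=
        (PolynormableSpace.withSeminorms ℂ (CompletedTensor E F)).toLocallyConvexSpace
      toMetrizableSpace := UniformSpace.metrizableSpace }

/-- A closed subspace of a Fréchet space is a Fréchet space. -/
theorem Submodule.frechetSpace {E : Type*} [AddCommGroup E] [Module ℂ E] [UniformSpace E]
    [FrechetSpace E] (N : Submodule ℂ E) (hN : IsClosed (N : Set E)) : FrechetSpace N :=
  { toIsUniformAddGroup := inferInstanceAs (IsUniformAddGroup N.toAddSubgroup)
    toLocallyConvexSpace := LocallyConvexSpace.induced
      (N.subtype.restrictScalars ℝ)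
    toCompleteSpace := hN.completeSpace_coe
    toMetrizableSpace := Topology.IsEmbedding.subtypeVal.metrizableSpace }

instance Omega.frechetSpace (A : Type*) [Ring A] [Algebra ℂ A] [UniformSpace A]
    [FrechetAlgebra A] : FrechetSpace (Omega A) :=
  Submodule.frechetSpace (LinearMap.ker (FrechetAlgebra.mulMap A).toLinearMap)
    ((isClosed_singleton (x := (0 : A))).preimage (FrechetAlgebra.mulMap A).continuous)

/-! ## Quotients of Fréchet bimodules -/

/-- A quotient of a Fréchet space by a closed subspace is a Fréchet space. -/
theorem Submodule.frechetSpace_quotient {E : Type*} [AddCommGroup E] [Module ℂ E]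
    [UniformSpace E] [FrechetSpace E] (N : Submodule ℂ E) (hN : IsClosed (N : Set E)) :
    @FrechetSpace (E ⧸ N) _ _ (IsTopologicalAddGroup.rightUniformSpace (E ⧸ N)) := by
  let _ : UniformSpace (E ⧸ N) := IsTopologicalAddGroup.rightUniformSpace (E ⧸ N)
  have hu : IsUniformAddGroup (E ⧸ N) := isUniformAddGroup_of_addCommGroup
  -- First countability of `E` is essential here: a quotient of a general complete locally convex
  -- space by a closed subspace may fail to be complete.
  have hcomp : CompleteSpace (E ⧸ N) :=
    QuotientAddGroup.completeSpace_right E N.toAddSubgroup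
  have hcount : (𝓝 (0 : E ⧸ N)).IsCountablyGenerated := by
    have h := N.isOpenMap_mkQ.map_nhds_eq N.mkQL.continuous.continuousAt (x := 0)
    rw [map_zero] at h
    rw [← h]
    infer_instance
  have : (uniformity (E ⧸ N)).IsCountablyGenerated :=
    IsUniformAddGroup.uniformity_countably_generated
  have : ContinuousSMul ℝ E := IsScalarTower.continuousSMul ℂ
  have hs : ContinuousSMul ℂ (E ⧸ N) := inferInstance
  have : ContinuousSMul ℝ (E ⧸ N) := IsScalarTower.continuousSMul ℂ
  have hT : T2Space (E ⧸ N) := by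
    have := hN
    infer_instance
  refine { toLocallyConvexSpace := ?_, toMetrizableSpace := UniformSpace.metrizableSpace }
  rw [locallyConvexSpace_iff_exists_convex_subset_zero]
  intro U hU
  -- A convex neighbourhood is found upstairs in the preimage and pushed down; the quotient map is
  -- linear and open, so the image is convex and a neighbourhood of zero.
  have hU' : N.mkQL ⁻¹' U ∈ 𝓝 0 :=
    N.mkQL.continuous.continuousAt.preimage_mem_nhds (by rwa [map_zero])
  obtain ⟨V, hV, hVc, hVU⟩ := (locallyConvexSpace_iff_exists_convex_subset_zero ℝ E).1
    inferInstance _ hU'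
  refine ⟨N.mkQL '' V, ?_, hVc.linear_image (N.mkQ.restrictScalars ℝ),
    Set.image_subset_iff.2 hVU⟩
  have := N.isOpenMap_mkQ.image_mem_nhds hV
  rwa [map_zero] at this

section QuotientBimodule

variable (B M : Type*) [Ring B] [Algebra ℂ B] [UniformSpace B]
  [AddCommGroup M] [Module ℂ M] [UniformSpace M] [Module B M] [Module Bᵐᵒᵖ M]

/-- A closed subbimodule of a topological bimodule. -/
structure ClosedSubbimodule extends Submodule ℂ M where
  left_mem : ∀ (b : B) {x : M}, x ∈ carrier → b • x ∈ carrier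
  right_mem : ∀ (b : Bᵐᵒᵖ) {x : M}, x ∈ carrier → b • x ∈ carrier
  isClosed : IsClosed carrier

namespace ClosedSubbimodule

variable {B M} (N : ClosedSubbimodule B M)

/-- The quotient by a closed subbimodule. -/
def Quotient : Type _ := M ⧸ N.toSubmodule

namespace Quotient

instance : AddCommGroup N.Quotient := inferInstanceAs (AddCommGroup (M ⧸ N.toSubmodule))
instance : Module ℂ N.Quotient := inferInstanceAs (Module ℂ (M ⧸ N.toSubmodule))

variable [FrechetSpace M]

instance : UniformSpace N.Quotient :=
  IsTopologicalAddGroup.rightUniformSpace (M ⧸ N.toSubmodule)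

instance : FrechetSpace N.Quotient := N.toSubmodule.frechetSpace_quotient N.isClosed

/-- The quotient map. -/
def mk : M →L[ℂ] N.Quotient := N.toSubmodule.mkQL

variable {N}

theorem mk_surjective : Function.Surjective (mk N) := Submodule.mkQ_surjective _

theorem mk_eq_zero {x : M} : mk N x = 0 ↔ x ∈ N.toSubmodule := Submodule.Quotient.mk_eq_zero _

/-- Openness ensures that `id × mk` is again a quotient map, which can fail for arbitrary quotient
maps. Joint continuity of the two actions on the quotient is tested along this product. -/
theorem isOpenQuotientMap_mk : IsOpenQuotientMap (mk N) :=
  ⟨mk_surjective, (mk N).continuous, N.toSubmodule.isOpenMap_mkQ⟩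

variable [FrechetAlgebra B] [ContinuousBimodule B M]

instance : SMul B N.Quotient where
  smul b := N.toSubmodule.mapQ N.toSubmodule
    ({ toFun := fun x => b • x
       map_add' := smul_add b
       map_smul' := fun c x => smul_algebra_smul_comm c b x } : M →ₗ[ℂ] M)
    (fun _ hx => N.left_mem b hx)

instance : SMul Bᵐᵒᵖ N.Quotient where
  smul b := N.toSubmodule.mapQ N.toSubmodule (ModTensor.opSMul b).toLinearMap
    (fun _ hx => N.right_mem b hx)

theorem mk_smul (b : B) (x : M) : mk N (b • x) = b • mk N x := rfl

theorem mk_op_smul (b : Bᵐᵒᵖ) (x : M) : mk N (b • x) = b • mk N x := rfl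

instance : Module B N.Quotient :=
  mk_surjective.module B (mk N).toLinearMap.toAddMonoidHom mk_smul

instance : Module Bᵐᵒᵖ N.Quotient :=
  mk_surjective.module Bᵐᵒᵖ (mk N).toLinearMap.toAddMonoidHom mk_op_smul

instance : ContinuousBimodule B N.Quotient where
  smul_assoc c b x := by
    obtain ⟨x, rfl⟩ := mk_surjective x
    rw [← mk_smul, ← mk_smul, ← map_smul, smul_assoc]
  isScalarTower_op := ⟨fun c b x => by
    obtain ⟨x, rfl⟩ := mk_surjective x
    rw [← mk_op_smul, ← mk_op_smul, ← map_smul, smul_assoc]⟩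
  smul_comm a b x := by
    obtain ⟨x, rfl⟩ := mk_surjective x
    rw [← mk_smul, ← mk_op_smul, ← mk_op_smul, ← mk_smul, smul_comm]
  continuous_smul :=
    ((IsOpenQuotientMap.id.prodMap isOpenQuotientMap_mk).isQuotientMap.continuous_iff).2
      ((mk N).continuous.comp (continuous_smul : Continuous fun z : B × M => z.1 • z.2))
  continuousSMul_op :=
    ⟨((IsOpenQuotientMap.id.prodMap isOpenQuotientMap_mk).isQuotientMap.continuous_iff).2
      ((mk N).continuous.comp (continuous_smul : Continuous fun z : Bᵐᵒᵖ × M => z.1 • z.2))⟩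

end Quotient

end ClosedSubbimodule

end QuotientBimodule

/-! ## Derivations and one-forms -/

section Derivations

variable {A B : Type*} [Ring A] [Algebra ℂ A] [UniformSpace A] [FrechetAlgebra A]
  [Ring B] [Algebra ℂ B] [UniformSpace B] [FrechetAlgebra B]

theorem Der.map_mul {M : Type*} [AddCommGroup M] [Module ℂ M] [UniformSpace M] [FrechetSpace M]
    [Module A M] [Module Aᵐᵒᵖ M] [ContinuousBimodule A M] (D : Der A M) (a b : A) :
    D.1 (a * b) = a • D.1 b + op b • D.1 a :=
  D.2 a b

theorem Der.map_one {M : Type*} [AddCommGroup M] [Module ℂ M] [UniformSpace M] [FrechetSpace M]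
    [Module A M] [Module Aᵐᵒᵖ M] [ContinuousBimodule A M] (D : Der A M) : D.1 1 = 0 := by
  have h := Der.map_mul D 1 1
  rwa [mul_one, one_smul, op_one, one_smul, left_eq_add] at h

/-- The universal derivation `b ↦ 1 ⊗ b - b ⊗ 1`. -/
def Omega.d (B : Type*) [Ring B] [Algebra ℂ B] [UniformSpace B] [FrechetAlgebra B] :
    Der B (Omega B) :=
  ⟨{ toFun := fun b => ⟨CompletedTensor.mk B B 1 b - CompletedTensor.mk B B b 1, by
        change FrechetAlgebra.mulMap B (CompletedTensor.tmul 1 b - CompletedTensor.tmul b 1) = 0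
        rw [map_sub, FrechetAlgebra.mulMap_tmul, FrechetAlgebra.mulMap_tmul, one_mul, mul_one,
          sub_self]⟩
     map_add' := fun a b => incl_injective (by
        change CompletedTensor.mk B B 1 (a + b) - CompletedTensor.mk B B (a + b) 1 =
          (CompletedTensor.mk B B 1 a - CompletedTensor.mk B B a 1) +
            (CompletedTensor.mk B B 1 b - CompletedTensor.mk B B b 1)
        rw [map_add, map_add, LinearMap.add_apply]
        abel)
     map_smul' := fun c b => incl_injective (by
        change CompletedTensor.mk B B 1 (c • b) - CompletedTensor.mk B B (c • b) 1 =
          c • (CompletedTensor.mk B B 1 b - CompletedTensor.mk B B b 1)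
        rw [_root_.map_smul, _root_.map_smul, LinearMap.smul_apply, smul_sub])
     cont := isInducing_incl.continuous_iff.2
        ((CompletedTensor.continuous_mk.comp (Continuous.prodMk_right 1)).sub
          (CompletedTensor.continuous_mk.comp (Continuous.prodMk_left 1))) },
    fun a b => incl_injective (by
      change CompletedTensor.tmul 1 (a * b) - CompletedTensor.tmul (a * b) 1 =
        FrechetAlgebra.leftAct B a (CompletedTensor.tmul 1 b - CompletedTensor.tmul b 1) +
          FrechetAlgebra.rightAct B b (CompletedTensor.tmul 1 a - CompletedTensor.tmul a 1)
      rw [map_sub, map_sub, FrechetAlgebra.leftAct_tmul, FrechetAlgebra.leftAct_tmul,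
        FrechetAlgebra.rightAct_tmul, FrechetAlgebra.rightAct_tmul, mul_one, one_mul]
      abel)⟩

theorem Omega.incl_d (b : B) :
    Omega.incl B ((Omega.d B).1 b) = CompletedTensor.tmul 1 b - CompletedTensor.tmul b 1 := rfl

/-- Naturality of the universal derivation: as `φ` is unital, both sides are `1 ⊗ φ a - φ a ⊗ 1`. It
places `d (φ a)` in the image of `Ω¹A`. -/
theorem Omega.map_d (φ : A →A[ℂ] B) (a : A) :
    Omega.map φ ((Omega.d A).1 a) = (Omega.d B).1 (φ a) :=
  incl_injective (by
    rw [incl_map, incl_d, incl_d, map_sub, CompletedTensor.map_tmul, CompletedTensor.map_tmul]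
    simp)

variable {X : Type*} [AddCommGroup X] [Module ℂ X] [UniformSpace X] [FrechetSpace X]
  [Module B X] [Module Bᵐᵒᵖ X] [ContinuousBimodule B X]

/-- The continuous linear map `x ⊗ y ↦ x • D y` given by a derivation `D`. -/
def Der.tensorMap (D : Der B X) : CompletedTensor B B →L[ℂ] X :=
  CompletedTensor.lift
    (LinearMap.mk₂ ℂ (fun x y => x • D.1 y)
      (fun x x' y => add_smul x x' _)
      (fun c x y => smul_assoc c x _)
      (fun x y y' => by rw [map_add, smul_add])
      (fun c x y => by rw [map_smul, smul_algebra_smul_comm]))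
    (continuous_fst.smul (D.1.continuous.comp continuous_snd))

theorem Der.tensorMap_tmul (D : Der B X) (x y : B) :
    (Der.tensorMap D) (.tmul x y) = x • D.1 y :=
  CompletedTensor.lift_tmul _ _ x y

theorem Der.tensorMap_d (D : Der B X) (b : B) :
    (Der.tensorMap D) (Omega.incl B ((Omega.d B).1 b)) = D.1 b := by
  rw [Omega.incl_d, map_sub, Der.tensorMap_tmul D, Der.tensorMap_tmul D, Der.map_one D, one_smul, smul_zero,
    sub_zero]

/-- Multiplication by `b` on the left as a continuous linear map. -/
def ContinuousBimodule.leftSMul (b : B) : X →L[ℂ] X where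
  toFun x := b • x
  map_add' := smul_add b
  map_smul' c x := smul_algebra_smul_comm c b x
  cont := continuous_const_smul b

theorem Der.tensorMap_leftAct (D : Der B X) (b : B) (t : CompletedTensor B B) :
    (Der.tensorMap D) (FrechetAlgebra.leftAct B b t) = b • (Der.tensorMap D) t :=
  DFunLike.congr_fun (CompletedTensor.ext
    (f := (Der.tensorMap D).comp (FrechetAlgebra.leftAct B b))
    (g := (ContinuousBimodule.leftSMul b).comp (Der.tensorMap D)) fun x y => by
      change (Der.tensorMap D) (FrechetAlgebra.leftAct B b (.tmul x y)) = b • (Der.tensorMap D) (.tmul x y)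
      rw [FrechetAlgebra.leftAct_tmul, Der.tensorMap_tmul D, Der.tensorMap_tmul D, mul_smul]) t

/-- By the Leibniz rule, `x D(yb) = xy D(b) + x D(y) b`. Right linearity thus fails only by a term
that depends on the product `xy`, and this term disappears on the kernel of multiplication; that is
why `D` induces a bimodule morphism on one-forms. -/
theorem Der.tensorMap_rightAct (D : Der B X) (b : B) (t : CompletedTensor B B) :
    (Der.tensorMap D) (FrechetAlgebra.rightAct B b t) =
      FrechetAlgebra.mulMap B t • D.1 b + op b • (Der.tensorMap D) t := by
  let r : B →L[ℂ] X :=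
    { toFun := fun x => x • D.1 b
      map_add' := fun x y => add_smul x y _
      map_smul' := fun c x => smul_assoc c x _
      cont := continuous_id.smul continuous_const }
  exact DFunLike.congr_fun (CompletedTensor.ext
    (f := (Der.tensorMap D).comp (FrechetAlgebra.rightAct B b))
    (g := r.comp (FrechetAlgebra.mulMap B) + (ModTensor.opSMul (op b)).comp (Der.tensorMap D))
    fun x y => by
      change (Der.tensorMap D) (FrechetAlgebra.rightAct B b (.tmul x y)) =
        FrechetAlgebra.mulMap B (.tmul x y) • D.1 b + op b • (Der.tensorMap D) (.tmul x y)
      rw [FrechetAlgebra.rightAct_tmul, FrechetAlgebra.mulMap_tmul, Der.tensorMap_tmul D,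
        Der.tensorMap_tmul D, Der.map_mul D, smul_add, mul_smul, smul_comm x (op b)]) t

/-- The continuous linear map on one-forms given by a derivation. -/
def Der.omegaMap (D : Der B X) : Omega B →L[ℂ] X := (Der.tensorMap D).comp (Omega.incl B)

theorem Der.omegaMap_d (D : Der B X) (b : B) : (Der.omegaMap D) ((Omega.d B).1 b) = D.1 b :=
  Der.tensorMap_d D b

theorem Der.omegaMap_smul (D : Der B X) (b : B) (ω : Omega B) :
    (Der.omegaMap D) (b • ω) = b • (Der.omegaMap D) ω :=
  Der.tensorMap_leftAct D b (Omega.incl B ω)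

theorem Der.omegaMap_op_smul (D : Der B X) (b : Bᵐᵒᵖ) (ω : Omega B) :
    (Der.omegaMap D) (b • ω) = b • (Der.omegaMap D) ω := by
  have h := Der.tensorMap_rightAct D b.unop (Omega.incl B ω)
  rwa [Omega.mulMap_incl, zero_smul, zero_add] at h

/-- The universal derivation induces the identity on one-forms. -/
theorem Der.omegaMap_omega_d (ω : Omega B) : (Der.omegaMap (Omega.d B)) ω = ω := by
  let r : B →L[ℂ] CompletedTensor B B :=
    { toLinearMap := (CompletedTensor.mk B B).flip 1
      cont := CompletedTensor.continuous_mk.comp (Continuous.prodMk_left 1) }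
  -- Since `x · d y = x ⊗ y - xy ⊗ 1`, the composite is the identity minus a map factoring through
  -- multiplication, which is zero on one-forms.
  have h : (Omega.incl B).comp (Der.tensorMap (Omega.d B)) =
      .id ℂ _ - r.comp (FrechetAlgebra.mulMap B) := CompletedTensor.ext fun x y => by
    change Omega.incl B ((Der.tensorMap (Omega.d B)) (.tmul x y)) =
      .tmul x y - .tmul (FrechetAlgebra.mulMap B (.tmul x y)) 1
    rw [Der.tensorMap_tmul, Omega.incl_smul, Omega.incl_d, map_sub, FrechetAlgebra.leftAct_tmul,
      FrechetAlgebra.leftAct_tmul, FrechetAlgebra.mulMap_tmul, mul_one]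
  refine Omega.incl_injective ((DFunLike.congr_fun h (Omega.incl B ω)).trans ?_)
  change Omega.incl B ω - r (FrechetAlgebra.mulMap B (Omega.incl B ω)) = _
  rw [Omega.mulMap_incl, map_zero, sub_zero]

/-! ### Derivations vanishing on `A` and the canonical map -/

variable (φ : A →A[ℂ] B)

theorem Der.restrict_eq_zero_iff (D : Der B X) :
    Der.restrict φ X D = 0 ↔ ∀ a, D.1 (φ a) = 0 :=
  ⟨fun h a => DFunLike.congr_fun (congrArg Subtype.val h) a,
    fun h => Subtype.ext (ContinuousLinearMap.ext h)⟩

/-- The map on one-forms given by a derivation vanishing on `A` annihilates the image of the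
canonical map. -/
theorem Der.omegaMap_comp_canonicalMap (D : Der B X) (hD : ∀ a, D.1 (φ a) = 0) :
    (Der.omegaMap D).comp (canonicalMap φ) = 0 := by
  -- On elementary tensors the value is `φ(x) D(φ(y)) = 0`, so the vanishing holds on all of `A ⊗̂
  -- A`. Linearity over `B` on the left and then on the right extends it, on one-forms, to the
  -- canonical map.
  have h1 : (Der.tensorMap D).comp
      (CompletedTensor.map φ.toContinuousLinearMap φ.toContinuousLinearMap) = 0 :=
    CompletedTensor.ext fun x y => by
      change (Der.tensorMap D) (CompletedTensor.map _ _ (.tmul x y)) = 0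
      rw [CompletedTensor.map_tmul, Der.tensorMap_tmul D]
      exact (congrArg _ (hD y)).trans (smul_zero _)
  have h2 : (Der.omegaMap D).comp (leftCanonicalMap φ) = 0 := ModTensor.ext fun b ω => by
    change (Der.omegaMap D) (leftCanonicalMap φ (.tmul A b ω)) = 0
    rw [leftCanonicalMap_tmul, Der.omegaMap_smul D]
    exact (congrArg _ (DFunLike.congr_fun h1 (Omega.incl A ω))).trans (smul_zero _)
  refine ModTensor.ext fun t b => ?_
  have h3 : canonicalMap φ (.tmul A t b) =
      op (Restrict.equiv φ B b) • leftCanonicalMap φ t :=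
    CompletedTensor.lift_tmul _ _ _ _
  change (Der.omegaMap D) (canonicalMap φ (.tmul A t b)) = 0
  rw [h3, Der.omegaMap_op_smul D]
  exact (congrArg _ (DFunLike.congr_fun h2 t)).trans (smul_zero _)

/-- The morphism on one-forms induced by `D` is continuous and zero on a dense set, hence zero; `D`
is recovered from it by composing with `d`. -/
theorem Der.restrict_injective_of_denseRange (h : DenseRange (canonicalMap φ)) :
    Function.Injective (Der.restrict φ X) := by
  refine (injective_iff_map_eq_zero _).2 fun D hD => ?_
  have h1 : ⇑(Der.omegaMap D) = 0 := h.equalizer (Der.omegaMap D).continuous continuous_zero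
    (congrArg DFunLike.coe
      (Der.omegaMap_comp_canonicalMap φ D ((Der.restrict_eq_zero_iff φ D).1 hD)))
  exact Subtype.ext (ContinuousLinearMap.ext fun b =>
    (Der.omegaMap_d D b).symm.trans (congrFun h1 _))

/-! ### Dense image from injectivity on derivations -/

/-- The closed subbimodule of `Ω¹ B` generated by the image of `Ω¹ A`. -/
def Omega.closedSpan : ClosedSubbimodule B (Omega B) :=
  let S : Set (Omega B) :=
    {η | ∃ (b b' : B) (ω : Omega A), η = op b' • b • Omega.map φ ω}
  -- The generating set is stable under multiplication by `B` on both sides, and a continuous linear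
  -- map that preserves a set preserves its closed span.
  have key : ∀ f : Omega B →L[ℂ] Omega B, Set.MapsTo f S S →
      ∀ η ∈ (Submodule.span ℂ S).topologicalClosure,
        f η ∈ (Submodule.span ℂ S).topologicalClosure := fun f hf _ hη =>
    map_mem_closure f.continuous hη fun _ hx =>
      (Submodule.span_le (p := (Submodule.span ℂ S).comap f.toLinearMap)).2
        (fun _ hs => Submodule.subset_span (hf hs)) hx
  { toSubmodule := (Submodule.span ℂ S).topologicalClosure
    left_mem := fun c _ hx => key (ContinuousBimodule.leftSMul c) (by
      rintro _ ⟨b, b', ω, rfl⟩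
      refine ⟨c * b, b', ω, ?_⟩
      rw [mul_smul, ← smul_comm c (op b')]
      rfl) _ hx
    right_mem := fun c _ hx => key (ModTensor.opSMul c) (by
      rintro _ ⟨b, b', ω, rfl⟩
      refine ⟨b, b' * c.unop, ω, ?_⟩
      rw [op_mul, op_unop, mul_smul]
      rfl) _ hx
    isClosed := Submodule.isClosed_topologicalClosure _ }

theorem Omega.map_mem_closedSpan (ω : Omega A) :
    Omega.map φ ω ∈ (Omega.closedSpan φ).toSubmodule :=
  Submodule.le_topologicalClosure _ (Submodule.subset_span ⟨1, 1, ω, by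
    rw [one_smul, op_one, one_smul]⟩)

/-- Each generator `b · φ(ω) · b'` is the value of the canonical map at `b ⊗ ω ⊗ b'`, and the range
of a linear map is already a subspace. -/
theorem Omega.closedSpan_subset_closure_range :
    ((Omega.closedSpan φ).toSubmodule : Set (Omega B)) ⊆ closure (Set.range (canonicalMap φ)) := by
  refine closure_mono ((Submodule.span_le
    (p := LinearMap.range (canonicalMap φ).toLinearMap)).2 ?_)
  rintro _ ⟨b, b', ω, rfl⟩
  refine ⟨.tmul A (.tmul A ((Restrict.equiv φ B).symm b) ω) ((Restrict.equiv φ B).symm b'), ?_⟩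
  exact Omega.incl_injective (incl_canonicalMap_tmul φ _ _ _)

/-- The derivation `B → Ω¹ B / N` induced by the universal one. -/
def ClosedSubbimodule.quotientDer (N : ClosedSubbimodule B (Omega B)) : Der B N.Quotient :=
  ⟨(Quotient.mk N).comp (Omega.d B).1, fun a b => by
    change Quotient.mk N ((Omega.d B).1 (a * b)) = _
    rw [Der.map_mul, map_add]
    rfl⟩

/-- If every `d y` has class zero, so has every `x · d y`, and by continuity the whole image of `x ⊗
y ↦ x · d y`. This map fixes one-forms, so the closed subbimodule is all of `Ω¹B`. -/
theorem denseRange_canonicalMap_of_quotientDer_eq_zero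
    (h : (Omega.closedSpan φ).quotientDer = 0) : DenseRange (canonicalMap φ) := by
  intro ω
  refine Omega.closedSpan_subset_closure_range φ
    (ClosedSubbimodule.Quotient.mk_eq_zero.1 ?_)
  have h1 : (ClosedSubbimodule.Quotient.mk (Omega.closedSpan φ)).comp (Der.tensorMap (Omega.d B)) = 0 :=
    CompletedTensor.ext fun x y => by
      change ClosedSubbimodule.Quotient.mk _ ((Der.tensorMap (Omega.d B)) (.tmul x y)) = 0
      rw [Der.tensorMap_tmul, ClosedSubbimodule.Quotient.mk_smul]
      exact (congrArg _ (DFunLike.congr_fun (congrArg Subtype.val h) y)).trans (smul_zero x)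
  rw [← Der.omegaMap_omega_d ω]
  exact DFunLike.congr_fun h1 (Omega.incl B ω)

/-- Condition (ii) is needed for just one bimodule, the quotient of `Ω¹B` by the closed span, and
for just one derivation, the class of `d`. -/
theorem denseRange_canonicalMap_of_restrict_injective
    (h : Function.Injective (Der.restrict φ (Omega.closedSpan φ).Quotient)) :
    DenseRange (canonicalMap φ) :=
  denseRange_canonicalMap_of_quotientDer_eq_zero φ <| (injective_iff_map_eq_zero _).1 h _ <|
    (Der.restrict_eq_zero_iff φ _).2 fun a => by
      change ClosedSubbimodule.Quotient.mk _ ((Omega.d B).1 (φ a)) = 0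
      rw [← Omega.map_d]
      exact ClosedSubbimodule.Quotient.mk_eq_zero.2 (Omega.map_mem_closedSpan φ _)

end Derivations

/-! ## Epimorphisms and derivations -/

section Epi

variable {B : Type*} [Ring B] [Algebra ℂ B] [UniformSpace B] [FrechetAlgebra B]

/-- Makes `B ⊕ X`, with the product topology, an admissible target in the category, so that an
epimorphism can be tested against derivations. -/
instance TrivSqZeroExt.frechetAlgebra (X : Type*) [AddCommGroup X] [Module ℂ X] [UniformSpace X]
    [FrechetSpace X] [Module B X] [Module Bᵐᵒᵖ X] [ContinuousBimodule B X] :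
    FrechetAlgebra (TrivSqZeroExt B X) where
  toContinuousSMul := inferInstanceAs (ContinuousSMul ℂ (B × X))
  toLocallyConvexSpace := inferInstanceAs (LocallyConvexSpace ℝ (B × X))
  toMetrizableSpace := inferInstanceAs (TopologicalSpace.MetrizableSpace (B × X))

/-- The homomorphism `b ↦ (b, D b)` into the trivial extension given by a derivation. -/
def Der.toTrivSqZeroExt {X : Type*} [AddCommGroup X] [Module ℂ X] [UniformSpace X]
    [FrechetSpace X] [Module B X] [Module Bᵐᵒᵖ X] [ContinuousBimodule B X] (D : Der B X) :
    B →A[ℂ] TrivSqZeroExt B X where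
  toAlgHom := AlgHom.ofLinearMap
    ({ toFun := fun b => (TrivSqZeroExt.inl b + TrivSqZeroExt.inr (D.1 b) : TrivSqZeroExt B X)
       map_add' := fun a b => by ext <;> simp
       map_smul' := fun c b => by ext <;> simp } : B →ₗ[ℂ] TrivSqZeroExt B X)
    (by
      change (TrivSqZeroExt.inl 1 + TrivSqZeroExt.inr (D.1 1) : TrivSqZeroExt B X) = 1
      rw [Der.map_one D]
      ext <;> simp)
    (fun a b => by
      change (TrivSqZeroExt.inl (a * b) + TrivSqZeroExt.inr (D.1 (a * b)) : TrivSqZeroExt B X) =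
        (TrivSqZeroExt.inl a + TrivSqZeroExt.inr (D.1 a)) *
          (TrivSqZeroExt.inl b + TrivSqZeroExt.inr (D.1 b))
      ext <;> simp [Der.map_mul D])
  cont := (TrivSqZeroExt.continuous_inl.add
    (TrivSqZeroExt.continuous_inr.comp D.1.continuous) :)

theorem Der.snd_toTrivSqZeroExt {X : Type*} [AddCommGroup X] [Module ℂ X] [UniformSpace X]
    [FrechetSpace X] [Module B X] [Module Bᵐᵒᵖ X] [ContinuousBimodule B X] (D : Der B X) (b : B) :
    ((Der.toTrivSqZeroExt D) b).snd = D.1 b := by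
  change (TrivSqZeroExt.inl b + TrivSqZeroExt.inr (D.1 b) : TrivSqZeroExt B X).snd = _
  simp

/-! ### The bimodule attached to a pair of homomorphisms -/

/-- The target of two homomorphisms `g, h : B → C` as a `B`-bimodule, `B` acting through `g` on the
left and through `h` on the right. -/
def TwoSided {C : Type*} [Ring C] [Algebra ℂ C] [UniformSpace C] (_ _ : B →A[ℂ] C) : Type _ := C

namespace TwoSided

variable {C : Type*} [Ring C] [Algebra ℂ C] [UniformSpace C] [FrechetAlgebra C] (g h : B →A[ℂ] C)

instance : AddCommGroup (TwoSided g h) := inferInstanceAs (AddCommGroup C)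
instance : Module ℂ (TwoSided g h) := inferInstanceAs (Module ℂ C)
instance : UniformSpace (TwoSided g h) := inferInstanceAs (UniformSpace C)
instance : FrechetSpace (TwoSided g h) := inferInstanceAs (FrechetSpace C)
instance : Module B (TwoSided g h) := Module.compHom C (g : B →+* C)
instance : Module Bᵐᵒᵖ (TwoSided g h) := Module.compHom C (RingHom.op (h : B →+* C))

instance : ContinuousBimodule B (TwoSided g h) where
  smul_assoc c b x := by
    change g (c • b) * (show C from x) = c • (g b * (show C from x))
    rw [map_smul, smul_mul_assoc]
  isScalarTower_op := ⟨fun c b x => by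
    change (show C from x) * h (c • b.unop) = c • ((show C from x) * h b.unop)
    rw [map_smul, mul_smul_comm]⟩
  smul_comm a b x := by
    change g a * ((show C from x) * h b.unop) = g a * (show C from x) * h b.unop
    rw [mul_assoc]
  continuous_smul :=
    ((g.continuous.comp continuous_fst).mul continuous_snd : Continuous fun z : B × C => g z.1 * z.2)
  continuousSMul_op :=
    ⟨(continuous_snd.mul (h.continuous.comp (continuous_unop.comp continuous_fst)) :
      Continuous fun z : Bᵐᵒᵖ × C => z.2 * h z.1.unop)⟩

/-- The difference of two homomorphisms as a derivation. -/
def subDer : Der B (TwoSided g h) :=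
  ⟨(g.toContinuousLinearMap - h.toContinuousLinearMap : B →L[ℂ] C), fun a b => by
    -- The Leibniz rule holds because the mixed terms `g(a) h(b)` cancel; this is what dictates `g`
    -- on the left and `h` on the right.
    change g (a * b) - h (a * b) = g a * (g b - h b) + (g a - h a) * h b
    rw [map_mul, map_mul, mul_sub, sub_mul]
    abel⟩

end TwoSided

end Epi

end

/-! ### The equivalence of the three conditions -/

theorem mainTheorem5 (A B : Type u) [Ring A] [Algebra ℂ A] [UniformSpace A] [FrechetAlgebra A]
    [Ring B] [Algebra ℂ B] [UniformSpace B] [FrechetAlgebra B] (φ : A →A[ℂ] B) :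
    List.TFAE [
      Epi (FrechetAlg.ofHom φ),
      ∀ (X : Type u) [AddCommGroup X] [Module ℂ X] [UniformSpace X] [FrechetSpace X]
        [Module B X] [Module Bᵐᵒᵖ X] [ContinuousBimodule B X],
        Function.Injective (Der.restrict φ X),
      DenseRange (canonicalMap φ)] := by
  tfae_have 1 → 2 := by
    intro hφ X _ _ _ _ _ _ _ D E hDE
    have hDE' : ∀ a, D.1 (φ a) = E.1 (φ a) :=
      fun a => DFunLike.congr_fun (congrArg Subtype.val hDE) a
    -- The homomorphisms `b ↦ (b, D b)` and `b ↦ (b, E b)` coincide on `φ(A)`; cancelling `φ` and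
    -- taking second components gives `D = E`.
    have h : FrechetAlg.ofHom φ ≫ FrechetAlg.ofHom (Der.toTrivSqZeroExt D) =
        FrechetAlg.ofHom φ ≫ FrechetAlg.ofHom (Der.toTrivSqZeroExt E) := by
      refine ContinuousAlgHom.ext fun a => ?_
      change (TrivSqZeroExt.inl (φ a) + TrivSqZeroExt.inr (D.1 (φ a)) : TrivSqZeroExt B X) =
        TrivSqZeroExt.inl (φ a) + TrivSqZeroExt.inr (E.1 (φ a))
      rw [hDE']
    have h' : (Der.toTrivSqZeroExt D) = (Der.toTrivSqZeroExt E) := (cancel_epi _).1 h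
    refine Subtype.ext (ContinuousLinearMap.ext fun b => ?_)
    rw [← Der.snd_toTrivSqZeroExt D, ← Der.snd_toTrivSqZeroExt E, h']
  tfae_have 2 → 1 := by
    intro H
    refine ⟨fun {C} g h hgh => ?_⟩
    let g' : B →A[ℂ] C.carrier := g
    let h' : B →A[ℂ] C.carrier := h
    -- The derivation `g - h` vanishes on `φ(A)`, so injectivity for the two-sided bimodule makes it
    -- zero.
    have h0 : TwoSided.subDer g' h' = 0 :=
      (injective_iff_map_eq_zero _).1 (H (TwoSided g' h')) _ <|
        (Der.restrict_eq_zero_iff φ _).2 fun a =>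
          sub_eq_zero.2 (DFunLike.congr_fun (F := A →A[ℂ] C.carrier) hgh a)
    exact ContinuousAlgHom.ext (f := g') (g := h') fun b =>
      sub_eq_zero.1 (DFunLike.congr_fun (congrArg Subtype.val h0) b)
  tfae_have 2 → 3 := fun H => denseRange_canonicalMap_of_restrict_injective φ (H _)
  tfae_have 3 → 2 := by
    intro H X _ _ _ _ _ _ _
    exact Der.restrict_injective_of_denseRange φ H
  tfae_finish
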